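/- **Setting.** Let $0\ne A=[a_{ij}]\in\mathbb R^{N\times N}$ be skew-symmetric, $a=\max_{i,j}|a_{ij}|$ and $t>0$. Let $G_\omega$ be the weighted graph on $\{1,\dots,N\}$ whose edges are the pairs $\{i,j\}$ with $a_{ij}\ne0$, with weights $\omega(\{i,j\})=|a_{ij}|^2$, and let $$\Phi(t,G_\omega)=\sum_{k=0}^{\lfloor N/2\rfloor}\Big(\sum_{M}\prod_{e\in M}\omega(e)\Big)t^{\lfloor N/2\rfloor-k}$$ be its weighted matching polynomial, where $M$ runs over the matchings of $G_\omega$ with $k$ edges. For $\xi=(\xi_{ij})_{1\le i\le j\le N}$ put $Y_A(\xi)=[a_{ij}\,\xi_{\min(i,j)\max(i,j)}]_{i,j=1}^N$. Let $x=(x_{ij})_{1\le i\le j\le N}$ be independent standard real Gaussians, $Y_A=Y_A(x)$, and define $\tilde\Phi(t,G_\omega)>0$ by $\log\tilde\Phi(t,G_\omega)=\mathrm E\log\det(\sqrt t\,I_N+Y_A)$. **Theorem.** (1) The number $\det(\sqrt t\,I_N+Y_A(\xi))$ is positive for every $\xi$, and $\log\det(\sqrt t\,I_N+Y_A)$ is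 integrable. If $k\ge1$, $r\ge0$ and $\xi_1,\dots,\xi_k$ are independent copies of $x$, then $$\Pr\Big(\Big|\frac1k\sum_{l=1}^k\log\det(\sqrt t\,I_N+Y_A(\xi_l))-\log\tilde\Phi(t,G_\omega)\Big|\ge Nr\Big)\le 2\exp\Big(-\frac{tkNr^2}{2a^2}\Big).$$ (2) Let $\Phi^*=\Phi(t,G_\omega)$ if $N$ is even and $\Phi^*=\sqrt t\,\Phi(t,G_\omega)$ if $N$ is odd. Then $$\frac1N\log\tilde\Phi(t,G_\omega)\le\frac1N\log\Phi^*\le\frac1N\log\tilde\Phi(t,G_\omega)+\frac{a^2}{2t}.$$ (3) The geometric mean of sampled determinants is a fully-polynomial randomized approximation scheme for $\tilde\Phi(t,G_\omega)$. The machine is a real random access machine: a fixed finite program, with natural numbers as its only literals, acts on natural-number index registers and real memory cells; memory accesses, natural-number $+$, truncated $-$, $\times$, real $+,-,\times,\div,\sqrt{\ },\exp,\log$ (performed only where they are defined), comparisons, and drawing one standard Gaussian independent of the earlier ones cost one step each. There are one program and a constant $C$ such that, for all $N$, $A$, $t$ as above and all $\varepsilon,\delta\in(0,1)$, with $$k=\Big\lceil\frac{8a^2N\log(4/\delta)}{t\varepsilon^2}\Big\rceil,$$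 the program with input $(N,A,t,\varepsilon,\delta)$ has the following properties. For every outcome of its samples it halts after at most $$C\,N^3\Big(1+\frac{a^2N\log(4/\delta)}{t\varepsilon^2}\Big)$$ steps, and outputs $$Z=\Big(\prod_{l=1}^k\det(\sqrt t\,I_N+Y_A(\xi_l))\Big)^{1/k},$$ where the entries of $\xi_1,\dots,\xi_k$ are distinct terms, in positions determined by the input, of the sequence of independent standard Gaussian samples available to it. With probability at least $1-\delta$ one has simultaneously $$1-\varepsilon<\frac{Z}{\tilde\Phi(t,G_\omega)}<1+\varepsilon\qquad\text{and}\qquad |Y_A(\xi_l)_{ij}|\le a\sqrt{2\log\frac{N^2k}{\delta}}\quad\text{for all } l,i,j.$$ In particular the running time is bounded by a polynomial in $N+a^2/t$, $1/\varepsilon$ and $\log(1/\delta)$. -/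

import Mathlib

open scoped Matrix

/-! ### Weighted graphs and the weighted matching polynomial -/

namespace MatchPoly

/-- A matching of `G`, given as a finite set of edges: no two distinct edges have a common vertex. -/
def IsMatching {V : Type*} (G : SimpleGraph V) (M : Finset (Sym2 V)) : Prop :=
  (∀ e ∈ M, e ∈ G.edgeSet) ∧ ∀ e ∈ M, ∀ f ∈ M, e ≠ f → ∀ v, ¬ (v ∈ e ∧ v ∈ f)

open Classical in
/-- The finite set of `k`-matchings of `G`. -/
noncomputable def kMatchings {V : Type*} [Fintype V] (G : SimpleGraph V) (k : ℕ) :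
    Finset (Finset (Sym2 V)) :=
  Finset.univ.filter fun M => IsMatching G M ∧ M.card = k

/-- `φ(k, G_ω)`, the total weight of the `k`-matchings. -/
noncomputable def totalWeight {V : Type*} [Fintype V] (G : SimpleGraph V) (ω : Sym2 V → ℝ)
    (k : ℕ) : ℝ :=
  ∑ M ∈ kMatchings G k, ∏ e ∈ M, ω e

/-- The weighted matching polynomial `Φ(t, G_ω) = ∑_{k=0}^n φ(k, G_ω) t^(n-k)`, `n = ⌊#V/2⌋`. -/
noncomputable def matchingPolynomial {V : Type*} [Fintype V] (G : SimpleGraph V)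
    (ω : Sym2 V → ℝ) (t : ℝ) : ℝ :=
  ∑ k ∈ Finset.range (Fintype.card V / 2 + 1), totalWeight G ω k * t ^ (Fintype.card V / 2 - k)

/-! ### The weighted graph of a real skew-symmetric matrix, and the random matrix `Y_A` -/

theorem skew_apply {N : ℕ} {A : Matrix (Fin N) (Fin N) ℝ} (hA : Aᵀ = -A) (i j : Fin N) :
    A j i = -A i j := by
  have h := congrFun (congrFun hA i) j
  simpa using h

/-- The graph on `{0, …, N-1}` in which `i, j` are adjacent iff `a_ij ≠ 0`. -/
def graphOf {N : ℕ} (A : Matrix (Fin N) (Fin N) ℝ) (hA : Aᵀ = -A) : SimpleGraph (Fin N) where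
  Adj i j := A i j ≠ 0
  symm := ⟨fun i j h => by rw [skew_apply hA i j]; exact neg_ne_zero.mpr h⟩
  loopless := ⟨fun i h => h (by have := skew_apply hA i i; linarith)⟩

/-- The weight `ω((i,j)) = |a_ij|²`. -/
def weightOf {N : ℕ} (A : Matrix (Fin N) (Fin N) ℝ) (hA : Aᵀ = -A) : Sym2 (Fin N) → ℝ :=
  Sym2.lift ⟨fun i j => |A i j| ^ 2, fun i j => by simp [skew_apply hA i j]⟩

/-- `Φ(t, G_ω)` for the weighted graph `G_ω` of the skew-symmetric matrix `A`. -/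
noncomputable def Phi {N : ℕ} (A : Matrix (Fin N) (Fin N) ℝ) (hA : Aᵀ = -A) (t : ℝ) : ℝ :=
  matchingPolynomial (graphOf A hA) (weightOf A hA) t

/-- `a = max |a_ij|`. -/
noncomputable def maxAbs {N : ℕ} (A : Matrix (Fin N) (Fin N) ℝ) : ℝ :=
  ⨆ p : Fin N × Fin N, |A p.1 p.2|

/-- The matrix `Y_A(ξ) = [a_ij ξ_{min(i,j) max(i,j)}]`; the coordinates of `ξ` are indexed by the
`N(N+1)/2` unordered pairs (possibly `i = j`) of indices. -/
def Y {N : ℕ} (A : Matrix (Fin N) (Fin N) ℝ) (ξ : Sym2 (Fin N) → ℝ) :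
    Matrix (Fin N) (Fin N) ℝ :=
  Matrix.of fun i j => A i j * ξ s(i, j)

/-- `det (√t I + Y_A(ξ))`. -/
noncomputable def detY {N : ℕ} (A : Matrix (Fin N) (Fin N) ℝ) (t : ℝ)
    (ξ : Sym2 (Fin N) → ℝ) : ℝ :=
  (Real.sqrt t • (1 : Matrix (Fin N) (Fin N) ℝ) + Y A ξ).det

/-- The law of the vector of independent standard Gaussians `x_ij`, `i ≤ j`. -/
noncomputable def gaussianEntries (N : ℕ) : MeasureTheory.Measure (Sym2 (Fin N) → ℝ) :=
  MeasureTheory.Measure.pi fun _ => ProbabilityTheory.gaussianReal 0 1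

/-- `log Φ̃(t, G_ω) = E log det (√t I + Y_A)`. -/
noncomputable def logPhiTilde {N : ℕ} (A : Matrix (Fin N) (Fin N) ℝ) (t : ℝ) : ℝ :=
  ∫ ξ, Real.log (detY A t ξ) ∂(gaussianEntries N)

/-- `Φ̃(t, G_ω)`. -/
noncomputable def PhiTilde {N : ℕ} (A : Matrix (Fin N) (Fin N) ℝ) (t : ℝ) : ℝ :=
  Real.exp (logPhiTilde A t)

end MatchPoly

/-! ### A random access machine over the reals with a source of Gaussian samples

Programs are finite, their only literals are natural numbers, and every arithmetic operation,
memory access, test and sampling costs one step. -/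

namespace RealRAM

/-- Index registers, real memory cells, and the number of samples drawn so far. -/
structure State where
  idx : ℕ → ℕ
  mem : ℕ → ℝ
  pos : ℕ

/-- Expressions with natural number values (`sub` is truncated). -/
inductive IdxExp where
  | const (n : ℕ)
  | reg (r : ℕ)
  | add (e f : IdxExp)
  | sub (e f : IdxExp)
  | mul (e f : IdxExp)

def IdxExp.eval (σ : State) : IdxExp → ℕ
  | const n => n
  | reg r => σ.idx r
  | add e f => e.eval σ + f.eval σ
  | sub e f => e.eval σ - f.eval σ
  | mul e f => e.eval σ * f.eval σ

def IdxExp.cost : IdxExp → ℕ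
  | const _ => 1
  | reg _ => 1
  | add e f => e.cost + f.cost + 1
  | sub e f => e.cost + f.cost + 1
  | mul e f => e.cost + f.cost + 1

/-- Expressions with real values. -/
inductive RealExp where
  | ofIdx (e : IdxExp)
  | read (addr : IdxExp)
  | add (e f : RealExp)
  | sub (e f : RealExp)
  | mul (e f : RealExp)
  | div (e f : RealExp)
  | sqrt (e : RealExp)
  | exp (e : RealExp)
  | log (e : RealExp)

noncomputable def RealExp.eval (σ : State) : RealExp → ℝ
  | ofIdx e => (e.eval σ : ℝ)
  | read addr => σ.mem (addr.eval σ)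
  | add e f => e.eval σ + f.eval σ
  | sub e f => e.eval σ - f.eval σ
  | mul e f => e.eval σ * f.eval σ
  | div e f => e.eval σ / f.eval σ
  | sqrt e => Real.sqrt (e.eval σ)
  | exp e => Real.exp (e.eval σ)
  | log e => Real.log (e.eval σ)

/-- No division by zero, root of a negative number or logarithm of a nonpositive number occurs in
the evaluation. -/
def RealExp.Legal (σ : State) : RealExp → Prop
  | ofIdx _ => True
  | read _ => True
  | add e f => e.Legal σ ∧ f.Legal σ
  | sub e f => e.Legal σ ∧ f.Legal σ
  | mul e f => e.Legal σ ∧ f.Legal σ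
  | div e f => e.Legal σ ∧ f.Legal σ ∧ f.eval σ ≠ 0
  | sqrt e => e.Legal σ ∧ 0 ≤ e.eval σ
  | exp e => e.Legal σ
  | log e => e.Legal σ ∧ 0 < e.eval σ

def RealExp.cost : RealExp → ℕ
  | ofIdx e => e.cost + 1
  | read addr => addr.cost + 1
  | add e f => e.cost + f.cost + 1
  | sub e f => e.cost + f.cost + 1
  | mul e f => e.cost + f.cost + 1
  | div e f => e.cost + f.cost + 1
  | sqrt e => e.cost + 1
  | exp e => e.cost + 1
  | log e => e.cost + 1

/-- Tests: comparison of two natural numbers or of two reals. -/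
inductive Test where
  | idxLt (e f : IdxExp)
  | realLt (e f : RealExp)

def Test.Holds (σ : State) : Test → Prop
  | idxLt e f => e.eval σ < f.eval σ
  | realLt e f => e.eval σ < f.eval σ

def Test.Legal (σ : State) : Test → Prop
  | idxLt _ _ => True
  | realLt e f => e.Legal σ ∧ f.Legal σ

def Test.cost : Test → ℕ
  | idxLt e f => e.cost + f.cost + 1
  | realLt e f => e.cost + f.cost + 1

/-- Programs. -/
inductive Program where
  | skip
  | setIdx (r : ℕ) (e : IdxExp)
  | write (addr : IdxExp) (e : RealExp)
  | sample (addr : IdxExp)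
  | seq (p q : Program)
  | ite (b : Test) (p q : Program)
  | loop (b : Test) (p : Program)

/-- `Exec x p σ s τ`: with the samples `x 0, x 1, …`, the program `p` started in the state `σ` halts
in the state `τ` after `s` steps. `loop b p` is the loop "while `b` do `p`". -/
inductive Exec (x : ℕ → ℝ) : Program → State → ℕ → State → Prop where
  | skip (σ : State) : Exec x .skip σ 1 σ
  | setIdx (r : ℕ) (e : IdxExp) (σ : State) :
      Exec x (.setIdx r e) σ (e.cost + 1) { σ with idx := Function.update σ.idx r (e.eval σ) }
  | write (addr : IdxExp) (e : RealExp) (σ : State) (h : e.Legal σ) :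
      Exec x (.write addr e) σ (addr.cost + e.cost + 1)
        { σ with mem := Function.update σ.mem (addr.eval σ) (e.eval σ) }
  | sample (addr : IdxExp) (σ : State) :
      Exec x (.sample addr) σ (addr.cost + 1)
        { σ with mem := Function.update σ.mem (addr.eval σ) (x σ.pos), pos := σ.pos + 1 }
  | seq {p q : Program} {σ τ υ : State} {s s' : ℕ} (hp : Exec x p σ s τ) (hq : Exec x q τ s' υ) :
      Exec x (.seq p q) σ (s + s') υ
  | ite_true {b : Test} {p q : Program} {σ τ : State} {s : ℕ} (hl : b.Legal σ) (hb : b.Holds σ)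
      (hp : Exec x p σ s τ) : Exec x (.ite b p q) σ (b.cost + s) τ
  | ite_false {b : Test} {p q : Program} {σ τ : State} {s : ℕ} (hl : b.Legal σ)
      (hb : ¬ b.Holds σ) (hq : Exec x q σ s τ) : Exec x (.ite b p q) σ (b.cost + s) τ
  | loop_true {b : Test} {p : Program} {σ τ υ : State} {s s' : ℕ} (hl : b.Legal σ)
      (hb : b.Holds σ) (hp : Exec x p σ s τ) (hr : Exec x (.loop b p) τ s' υ) :
      Exec x (.loop b p) σ (b.cost + s + s') υ
  | loop_false {b : Test} {p : Program} {σ : State} (hl : b.Legal σ) (hb : ¬ b.Holds σ) :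
      Exec x (.loop b p) σ b.cost σ

/-- With the samples `x`, the program `p` started in `σ` halts after `s` steps and its output, the
content of the memory cell `0`, is `v`. -/
def HaltsWith (x : ℕ → ℝ) (p : Program) (σ : State) (s : ℕ) (v : ℝ) : Prop :=
  ∃ τ, Exec x p σ s τ ∧ τ.mem 0 = v

/-- The law of a sequence of independent standard Gaussian samples. -/
noncomputable def gaussianSamples : MeasureTheory.Measure (ℕ → ℝ) :=
  MeasureTheory.Measure.infinitePi fun _ => ProbabilityTheory.gaussianReal 0 1

/-- `p` is a fully-polynomial randomized approximation scheme for the positive quantity `f i`: on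
the instance `i` with parameters `ε, δ ∈ (0, 1)` it always halts, after a number of steps bounded
by a polynomial in `size i`, `1/ε` and `log (1/δ)`, and the quotient of its output by `f i` lies
strictly between `1 - ε` and `1 + ε` with probability at least `1 - δ`. -/
def IsFPRAS {I : Type*} (p : Program) (input : I → ℝ → ℝ → State) (size : I → ℝ)
    (f : I → ℝ) : Prop :=
  ∃ (C : ℝ) (d : ℕ), ∀ (i : I) (ε δ : ℝ), 0 < ε → ε < 1 → 0 < δ → δ < 1 →
    ∃ out : (ℕ → ℝ) → ℝ, Measurable out ∧
      (∀ x, ∃ s, HaltsWith x p (input i ε δ) s (out x) ∧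
        (s : ℝ) ≤ C * (1 + size i + 1 / ε + Real.log (1 / δ)) ^ d) ∧
      1 - δ ≤ gaussianSamples.real {x | 1 - ε < out x / f i ∧ out x / f i < 1 + ε}

end RealRAM

/-! ### The approximation problem for `Φ̃(t, G_ω)` -/

namespace MatchPoly

/-- An instance: a nonzero real skew-symmetric matrix and `t > 0`. -/
structure Instance where
  N : ℕ
  A : Matrix (Fin N) (Fin N) ℝ
  skew : Aᵀ = -A
  ne_zero : A ≠ 0
  t : ℝ
  t_pos : 0 < t

/-- The initial state of the machine: `N` in index register `0`; `t, ε, δ` in the memory cells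
`0, 1, 2`; `a_ij` in the memory cell `3 + N i + j`; zero elsewhere. -/
noncomputable def Instance.input (I : Instance) (ε δ : ℝ) : RealRAM.State where
  idx r := if r = 0 then I.N else 0
  mem m :=
    if m = 0 then I.t else if m = 1 then ε else if m = 2 then δ else
    if h : m - 3 < I.N * I.N then
      I.A (finProdFinEquiv.symm ⟨m - 3, h⟩).1 (finProdFinEquiv.symm ⟨m - 3, h⟩).2
    else 0
  pos := 0

/-- The size parameter `N + a²/t` in terms of which running times are measured. -/
noncomputable def Instance.size (I : Instance) : ℝ := I.N + maxAbs I.A ^ 2 / I.t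

/-- The number of samples `k = ⌈8 a² N log(4/δ) / (t ε²)⌉`. -/
noncomputable def Instance.sampleCount (I : Instance) (ε δ : ℝ) : ℕ :=
  ⌈8 * maxAbs I.A ^ 2 * I.N * Real.log (4 / δ) / (I.t * ε ^ 2)⌉₊

/-- The estimator `(∏_{l=1}^k det (√t I + Y_A(ξ_l)))^(1/k)`. -/
noncomputable def geomMeanDet {N : ℕ} (A : Matrix (Fin N) (Fin N) ℝ) (t : ℝ) {k : ℕ}
    (ξ : Fin k → Sym2 (Fin N) → ℝ) : ℝ :=
  (∏ l, detY A t (ξ l)) ^ ((1 : ℝ) / k)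

end MatchPoly

open MatchPoly MeasureTheory ProbabilityTheory

/-! The quadratic form of M = √t I + Y with Y skew-symmetric is √t |x|². All pivots of M are
therefore positive, det M > 0, and F = log det (√t I + Y_A) is a differentiable function of the
Gaussian vector.

Concentration rests on a Lipschitz bound and a Gaussian inequality. The derivative of F in a skew
direction H is tr(M⁻¹H). Since M is normal, C = MᵀM⁻¹ is orthogonal, and 2√t M⁻¹ = C + I. As tr H =
0, Cauchy–Schwarz gives tr(M⁻¹H)² ≤ N/(4t) · ‖H‖² in the Frobenius norm
(`trace_inv_mul_skew_sq_le`). Each variable fills two entries bounded by a times it, so F has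
squared Lipschitz constant L = a²N/(2t) (`log_detY_lipschitz`). On the Gaussian side,
Prékopa–Leindler on the line gives Maurey's property (τ) with cost |x-y|²/4, which tensorizes
(`hasPropertyTau_stdGauss`). Applied to e^(-L-F) and e^F it yields E e^(-F) · E e^F ≤ e^L, and
Jensen turns this into E e^F ≤ e^(EF + L). The sharp exponent would be L/2, but L gives exactly the
stated constants: Chernoff's bound for the mean of k copies is (1), and (2) is the same moment bound
for F itself together with Jensen, once E det is known.

For E det (`integral_detY_eq_Phi`), expand over permutations. A permutation with a cycle of length
at least three contains a centred variable to the first power and contributes zero. Involutions are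
the matchings of the complete graph: fixed points give √t, a transposition gives a_ij a_ji E x² =
-|a_ij|², and its sign cancels the minus.

The program finds a as the largest entry of A, computes the real number whose ceiling is k, and
repeatedly fills √t I + Y_A with fresh samples and performs Gaussian elimination without pivoting,
adding up the logarithms of the pivots. It outputs the exponential of their sum divided by k.
Correctness and cost are proved together by Hoare-style rules (`Runs`). The failure probability
splits into δ/2 for the concentration bound and δ/2 for a union bound over the Gaussian tails. -/

namespace MatchPoly

open scoped ENNReal

/-! ### Prékopa–Leindler on the line and property (τ) of Gaussian measures -/

/-- The one-dimensional Brunn–Minkowski inequality. -/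
theorem volume_add_volume_le {A B C : Set ℝ} (hA : MeasurableSet A) (hB : MeasurableSet B)
    (hA0 : A.Nonempty) (hB0 : B.Nonempty) (h : ∀ x ∈ A, ∀ y ∈ B, x + y ∈ C) :
    volume A + volume B ≤ volume C := by
  have key : ∀ K L : Set ℝ, IsCompact K → IsCompact L → K.Nonempty → L.Nonempty →
      K ⊆ A → L ⊆ B → volume K + volume L ≤ volume C := by
    intro K L hK hL hK0 hL0 hKA hLB
    obtain ⟨p, hp, hpmax⟩ := hK.exists_isGreatest hK0
    obtain ⟨q, hq, hqmin⟩ := hL.exists_isLeast hL0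
    -- With p = max K and q = min L, the translates K + q and L + p both lie in C and can meet only
    -- at p + q; removing q from L makes them disjoint.
    have h1 : volume ((fun x => x + -q) ⁻¹' K) = volume K := measure_preimage_add_right _ _ _
    have h2 : volume ((fun x => x + -p) ⁻¹' (L \ {q})) = volume (L \ {q}) :=
      measure_preimage_add_right _ _ _
    have h3 : volume (L \ {q}) = volume L := measure_sdiff_null (by simp)
    rw [← h3, ← h2, ← h1, ← measure_union]
    · apply measure_mono
      rintro z (hz | hz)
      · have := h _ (hKA hz) q (hLB hq)
        simpa using this
      · have := h p (hKA hp) _ (hLB hz.1)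
        simpa using this
    · rw [Set.disjoint_left]
      rintro z hz1 ⟨hz2, hz3⟩
      have e1 := hpmax hz1
      have e2 := hqmin hz2
      apply hz3
      simp only [Set.mem_singleton_iff]
      linarith
    · exact (hL.measurableSet.diff (measurableSet_singleton q)).preimage (by fun_prop)
  obtain ⟨p, hp⟩ := hA0
  obtain ⟨q, hq⟩ := hB0
  rw [hA.measure_eq_iSup_isCompact, hB.measure_eq_iSup_isCompact]
  simp only [iSup_and']
  refine ENNReal.biSup_add_biSup_le' ⟨∅, by simp⟩ ⟨∅, by simp⟩ ?_
  rintro K ⟨hKA, hK⟩ L ⟨hLB, hL⟩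
  -- The suprema include the empty compact set, for which the translation argument has no endpoint;
  -- adding one point of A and one of B repairs this.
  refine le_trans (add_le_add (measure_mono (Set.subset_insert p K))
    (measure_mono (Set.subset_insert q L))) ?_
  exact key _ _ (hK.insert p) (hL.insert q) (Set.insert_nonempty _ _) (Set.insert_nonempty _ _)
    (Set.insert_subset hp hKA) (Set.insert_subset hq hLB)

/-- The Prékopa–Leindler inequality on the line for functions with supremum one, in additive
form. -/
theorem lintegral_add_lintegral_le_of_sup_eq_one {f g h : ℝ → ℝ} (hf : Measurable f)
    (hg : Measurable g) (hh : Measurable h) (hf0 : ∀ x, 0 ≤ f x) (hg0 : ∀ x, 0 ≤ g x)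
    (hh0 : ∀ x, 0 ≤ h x) (hf1 : ∀ x, f x ≤ 1) (hg1 : ∀ x, g x ≤ 1)
    (hfs : ∀ s < 1, ∃ x, s < f x) (hgs : ∀ s < 1, ∃ x, s < g x)
    (hfgh : ∀ x y, f x * g y ≤ h ((x + y) / 2) ^ 2) :
    (∫⁻ x, ENNReal.ofReal (f x)) + ∫⁻ x, ENNReal.ofReal (g x) ≤
      2 * ∫⁻ x, ENNReal.ofReal (h x) := by
  rw [lintegral_eq_lintegral_meas_lt _ (.of_forall hf0) hf.aemeasurable,
    lintegral_eq_lintegral_meas_lt _ (.of_forall hg0) hg.aemeasurable,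
    lintegral_eq_lintegral_meas_lt _ (.of_forall hh0) hh.aemeasurable,
    ← lintegral_const_mul' _ _ (by simp), ← lintegral_add_left']
  · refine lintegral_mono_ae ?_
    filter_upwards [ae_restrict_mem measurableSet_Ioi] with s hs
    have hs0 : (0 : ℝ) < s := hs
    rcases lt_or_ge s 1 with hs1 | hs1
    -- Below level 1 both level sets are nonempty, and half of their sum lies in the level set of
    -- `h`. The set `C` is the dilation by 2 of that level set, whence the factor 2; levels from 1
    -- on contribute nothing on the left.
    · have := volume_add_volume_le (A := {x | s < f x}) (B := {x | s < g x})
        (C := (fun z => (1 / 2 : ℝ) * z) ⁻¹' {x | s < h x})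
        (measurableSet_lt measurable_const hf) (measurableSet_lt measurable_const hg)
        (hfs s hs1) (hgs s hs1) ?_
      · rw [Real.volume_preimage_mul_left (by norm_num)] at this
        refine this.trans_eq ?_
        norm_num
      · intro x hx y hy
        simp only [Set.mem_ofPred_eq, Set.mem_preimage] at hx hy ⊢
        have e := hfgh x y
        rw [show 1 / 2 * (x + y) = (x + y) / 2 by ring]
        by_contra! hc
        nlinarith [hh0 ((x + y) / 2), mul_pos hs0 (hs0.trans hx)]
    · have h1 : {x | s < f x} = ∅ := by
        ext x; simp only [Set.mem_ofPred_eq, Set.mem_empty_iff_false, iff_false, not_lt]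
        exact (hf1 x).trans hs1
      have h2 : {x | s < g x} = ∅ := by
        ext x; simp only [Set.mem_ofPred_eq, Set.mem_empty_iff_false, iff_false, not_lt]
        exact (hg1 x).trans hs1
      simp [h1, h2]
  · exact (Antitone.measurable fun a b hab => measure_mono fun x (hx : b < f x) =>
      lt_of_le_of_lt hab hx).aemeasurable

/-- The Prékopa–Leindler inequality on the line for bounded functions. -/
theorem lintegral_mul_lintegral_le_sq {f g h : ℝ → ℝ} (hf : Measurable f)
    (hg : Measurable g) (hh : Measurable h) (hf0 : ∀ x, 0 ≤ f x) (hg0 : ∀ x, 0 ≤ g x)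
    (hh0 : ∀ x, 0 ≤ h x) (hfb : BddAbove (Set.range f)) (hgb : BddAbove (Set.range g))
    (hfp : ∃ x, 0 < f x) (hgp : ∃ x, 0 < g x)
    (hfgh : ∀ x y, f x * g y ≤ h ((x + y) / 2) ^ 2) :
    (∫⁻ x, ENNReal.ofReal (f x)) * ∫⁻ x, ENNReal.ofReal (g x) ≤
      (∫⁻ x, ENNReal.ofReal (h x)) ^ 2 := by
  have norm : ∀ f : ℝ → ℝ, BddAbove (Set.range f) → (∃ x, 0 < f x) → 0 < ⨆ x, f x := by
    rintro f hb ⟨x, hx⟩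
    exact hx.trans_le (le_ciSup hb x)
  have hM := norm f hfb hfp
  have hm := norm g hgb hgp
  have sup : ∀ f : ℝ → ℝ, 0 < (⨆ x, f x) → ∀ s < (1 : ℝ), ∃ x, s < f x / ⨆ x, f x := by
    intro f hM s hs
    obtain ⟨x, hx⟩ := exists_lt_of_lt_ciSup (show s * (⨆ x, f x) < ⨆ x, f x by nlinarith)
    exact ⟨x, by rwa [lt_div_iff₀ hM]⟩
  set M := ⨆ x, f x with hMdef
  set m := ⨆ x, g x with hmdef
  have hS : 0 < Real.sqrt (M * m) := Real.sqrt_pos.2 (mul_pos hM hm)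
  -- Dividing `f` and `g` by their suprema and `h` by √(Mm) preserves the midpoint hypothesis, so
  -- the additive form applies; AM–GM then makes it multiplicative.
  have key := lintegral_add_lintegral_le_of_sup_eq_one (f := fun x => f x / M)
    (g := fun x => g x / m) (h := fun x => h x / Real.sqrt (M * m))
    (hf.div_const _) (hg.div_const _) (hh.div_const _)
    (fun x => div_nonneg (hf0 x) hM.le) (fun x => div_nonneg (hg0 x) hm.le)
    (fun x => div_nonneg (hh0 x) hS.le)
    (fun x => by rw [div_le_one hM]; exact le_ciSup hfb x)
    (fun x => by rw [div_le_one hm]; exact le_ciSup hgb x)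
    (sup f hM) (sup g hm)
    (fun x y => by
      rw [div_pow, Real.sq_sqrt (mul_pos hM hm).le, div_mul_div_comm]
      exact div_le_div_of_nonneg_right (hfgh x y) (mul_pos hM hm).le)
  have scale : ∀ (f : ℝ → ℝ) (c : ℝ), 0 < c →
      ∫⁻ x, ENNReal.ofReal (f x) = ENNReal.ofReal c * ∫⁻ x, ENNReal.ofReal (f x / c) := by
    intro f c hc
    rw [← lintegral_const_mul' _ _ (by simp)]
    congr 1 with x
    rw [← ENNReal.ofReal_mul hc.le, mul_div_cancel₀ _ hc.ne']
  rw [scale f M hM, scale g m hm, scale h _ hS]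
  have amgm : ∀ a b c : ℝ≥0∞, a + b ≤ 2 * c → a * b ≤ c ^ 2 := by
    intro a b c key
    by_cases hc : c = ∞
    · simp [hc]
    · have h2 : a + b ≠ ∞ := ne_top_of_le_ne_top (ENNReal.mul_ne_top (by simp) hc) key
      obtain ⟨ha, hb⟩ := ENNReal.add_ne_top.1 h2
      lift a to NNReal using ha
      lift b to NNReal using hb
      lift c to NNReal using hc
      norm_cast at key ⊢
      rw [← NNReal.coe_le_coe] at key ⊢
      push_cast at key ⊢
      nlinarith [a.coe_nonneg, b.coe_nonneg, c.coe_nonneg, sq_nonneg ((a : ℝ) - b)]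
  have hab := amgm _ _ _ key
  set a := ∫⁻ x, ENNReal.ofReal (f x / M)
  set b := ∫⁻ x, ENNReal.ofReal (g x / m)
  set c := ∫⁻ x, ENNReal.ofReal (h x / Real.sqrt (M * m))
  calc _ = ENNReal.ofReal (M * m) * (a * b) := by rw [ENNReal.ofReal_mul hM.le]; ring
    _ ≤ ENNReal.ofReal (M * m) * c ^ 2 := by gcongr
    _ = _ := by
      rw [mul_pow, ← ENNReal.ofReal_pow hS.le, Real.sq_sqrt (mul_pos hM hm).le]

/-- The transport inequality satisfied by a pair of a measure `μ` and a cost `c`: Maurey's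
property `(τ)`, in multiplicative form. -/
def HasPropertyTau {α : Type*} [MeasurableSpace α] (μ : Measure α) (c : α → α → ℝ) : Prop :=
  ∀ u v : α → ℝ≥0∞, Measurable u → Measurable v →
    (∀ x y, u x * v y ≤ ENNReal.ofReal (Real.exp (c x y))) →
      (∫⁻ x, u x ∂μ) * ∫⁻ y, v y ∂μ ≤ 1

/-- Multiply u and v by e^(-x²/2). The parallelogram identity x²/2 + y²/2 = (x-y)²/4 + ((x+y)/2)²
turns the hypothesis into the midpoint condition of Prékopa–Leindler with h = e^(-x²/2). -/
theorem hasPropertyTau_gaussianReal :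
    HasPropertyTau (gaussianReal 0 1) fun x y => (x - y) ^ 2 / 4 := by
  intro u v hu hv huv
  by_cases hu0 : ∃ x, u x ≠ 0
  swap
  · push Not at hu0
    simp [hu0]
  by_cases hv0 : ∃ x, v x ≠ 0
  swap
  · push Not at hv0
    simp [hv0]
  have fin : ∀ a b : ℝ≥0∞, ∀ r : ℝ, a * b ≤ ENNReal.ofReal r → b ≠ 0 → a ≠ ∞ := by
    rintro a b r h hb rfl
    rw [ENNReal.top_mul hb] at h
    simp at h
  -- Prékopa–Leindler was proved for bounded functions. One point y with z(y) ≠ 0 gives a bound,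
  -- because (x-y)²/4 ≤ x²/2 + y²/2.
  have bdd : ∀ w z : ℝ → ℝ≥0∞, (∀ x, w x ≠ ∞) → (∀ x, z x ≠ ∞) → (∃ y, z y ≠ 0) →
      (∀ x y, w x * z y ≤ ENNReal.ofReal (Real.exp ((x - y) ^ 2 / 4))) →
      BddAbove (Set.range fun x => (w x).toReal * Real.exp (-x ^ 2 / 2)) := by
    rintro w z hw hz ⟨y, hy⟩ h
    have hzp : 0 < (z y).toReal := ENNReal.toReal_pos hy (hz y)
    refine ⟨Real.exp (y ^ 2 / 2) / (z y).toReal, ?_⟩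
    rintro _ ⟨x, rfl⟩
    have e := ENNReal.toReal_mono (by simp) (h x y)
    rw [ENNReal.toReal_mul, ENNReal.toReal_ofReal (Real.exp_pos _).le] at e
    simp only
    rw [le_div_iff₀ hzp, mul_right_comm]
    refine (mul_le_mul_of_nonneg_right e (Real.exp_pos _).le).trans ?_
    rw [← Real.exp_add, Real.exp_le_exp]
    nlinarith [sq_nonneg (x + y)]
  obtain ⟨x₀, hx₀⟩ := hu0
  obtain ⟨y₀, hy₀⟩ := hv0
  have hut : ∀ x, u x ≠ ∞ := fun x => fin _ _ _ (huv x y₀) hy₀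
  have hvt : ∀ y, v y ≠ ∞ := fun y => fin _ _ _ (by rw [mul_comm]; exact huv x₀ y) hx₀
  have key := lintegral_mul_lintegral_le_sq
    (f := fun x => (u x).toReal * Real.exp (-x ^ 2 / 2))
    (g := fun x => (v x).toReal * Real.exp (-x ^ 2 / 2))
    (h := fun x => Real.exp (-x ^ 2 / 2)) (by fun_prop) (by fun_prop) (by fun_prop)
    (fun x => by positivity) (fun x => by positivity) (fun x => by positivity)
    (bdd u v hut hvt ⟨y₀, hy₀⟩ huv)
    (bdd v u hvt hut ⟨x₀, hx₀⟩ fun x y => by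
      rw [mul_comm, show (x - y) ^ 2 = (y - x) ^ 2 by ring]; exact huv y x)
    ⟨x₀, mul_pos (ENNReal.toReal_pos hx₀ (hut _)) (Real.exp_pos _)⟩
    ⟨y₀, mul_pos (ENNReal.toReal_pos hy₀ (hvt _)) (Real.exp_pos _)⟩
    (fun x y => by
      have e := ENNReal.toReal_mono (by simp) (huv x y)
      rw [ENNReal.toReal_mul, ENNReal.toReal_ofReal (Real.exp_pos _).le] at e
      calc _ = (u x).toReal * (v y).toReal * (Real.exp (-x ^ 2 / 2) * Real.exp (-y ^ 2 / 2)) := by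
            ring
        _ ≤ Real.exp ((x - y) ^ 2 / 4) * (Real.exp (-x ^ 2 / 2) * Real.exp (-y ^ 2 / 2)) := by
            gcongr
        _ = _ := by
            rw [← Real.exp_add, ← Real.exp_add, ← Real.exp_nat_mul]
            congr 1
            push_cast
            ring)
  have pdf : ∀ w : ℝ → ℝ≥0∞, Measurable w → (∀ x, w x ≠ ∞) →
      ∫⁻ x, w x ∂(gaussianReal 0 1) = ENNReal.ofReal (Real.sqrt (2 * Real.pi))⁻¹ *
        ∫⁻ x, ENNReal.ofReal ((w x).toReal * Real.exp (-x ^ 2 / 2)) := by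
    intro w hw hwt
    rw [gaussianReal_of_var_ne_zero _ one_ne_zero,
      lintegral_withDensity_eq_lintegral_mul _ (measurable_gaussianPDF _ _) hw,
      ← lintegral_const_mul' _ _ ENNReal.ofReal_ne_top]
    congr 1 with x
    simp only [Pi.mul_apply, gaussianPDF, gaussianPDFReal]
    rw [← ENNReal.ofReal_mul (by positivity)]
    conv_lhs => rw [← ENNReal.ofReal_toReal (hwt x)]
    rw [← ENNReal.ofReal_mul (by positivity)]
    congr 1
    simp
    ring
  have one := pdf (fun _ => 1) measurable_const (by simp)
  simp only [lintegral_one, measure_univ, ENNReal.toReal_one, one_mul] at one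
  rw [pdf u hu hut, pdf v hv hvt]
  calc _ = ENNReal.ofReal (Real.sqrt (2 * Real.pi))⁻¹ ^ 2 *
        ((∫⁻ x, ENNReal.ofReal ((u x).toReal * Real.exp (-x ^ 2 / 2))) *
          ∫⁻ x, ENNReal.ofReal ((v x).toReal * Real.exp (-x ^ 2 / 2))) := by ring
    _ ≤ ENNReal.ofReal (Real.sqrt (2 * Real.pi))⁻¹ ^ 2 *
        (∫⁻ x, ENNReal.ofReal (Real.exp (-x ^ 2 / 2))) ^ 2 := by gcongr
    _ = 1 := by rw [← mul_pow, ← one, one_pow]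

/-- For fixed first coordinates x, y the property of ν applies to the slices e^(-c(x,y)) u(x,·) and
v(y,·). Its conclusion is the hypothesis of the property of μ for the slice integrals. -/
theorem HasPropertyTau.prod {α β : Type*} [MeasurableSpace α] [MeasurableSpace β]
    {μ : Measure α} {ν : Measure β} [SFinite μ] [SFinite ν] {c : α → α → ℝ} {d : β → β → ℝ}
    (hμ : HasPropertyTau μ c) (hν : HasPropertyTau ν d) :
    HasPropertyTau (μ.prod ν) fun x y => c x.1 y.1 + d x.2 y.2 := by
  intro u v hu hv huv
  rw [lintegral_prod _ hu.aemeasurable, lintegral_prod _ hv.aemeasurable]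
  refine hμ _ _ hu.lintegral_prod_right' hv.lintegral_prod_right' fun x y => ?_
  have hc : ENNReal.ofReal (Real.exp (c x y)) ≠ 0 := by simp [Real.exp_pos]
  have := hν (fun z => (ENNReal.ofReal (Real.exp (c x y)))⁻¹ * u (x, z)) (fun z => v (y, z))
    (by fun_prop) (by fun_prop) fun z w => by
      rw [mul_assoc, ENNReal.inv_mul_le_iff hc (by simp),
        ← ENNReal.ofReal_mul (Real.exp_pos _).le, ← Real.exp_add]
      exact huv (x, z) (y, w)
  rwa [lintegral_const_mul _ (by fun_prop), mul_assoc, ENNReal.inv_mul_le_iff hc (by simp),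
    mul_one] at this

theorem HasPropertyTau.of_measurePreserving {α β : Type*} [MeasurableSpace α] [MeasurableSpace β]
    {μ : Measure α} {ν : Measure β} {c : α → α → ℝ} {d : β → β → ℝ} (hμ : HasPropertyTau μ c)
    {φ : α → β} (hφ : MeasurePreserving φ μ ν) (h : ∀ x y, d (φ x) (φ y) = c x y) :
    HasPropertyTau ν d := by
  intro u v hu hv huv
  rw [← hφ.lintegral_comp hu, ← hφ.lintegral_comp hv]
  exact hμ _ _ (hu.comp hφ.measurable) (hv.comp hφ.measurable) fun x y => by
    rw [← h]; exact huv _ _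

/-- The standard Gaussian measure on a finite-dimensional space. -/
noncomputable def stdGauss (ι : Type*) [Fintype ι] : Measure (ι → ℝ) :=
  Measure.pi fun _ => gaussianReal 0 1

instance (ι : Type*) [Fintype ι] : IsProbabilityMeasure (stdGauss ι) := by
  unfold stdGauss; infer_instance

theorem hasPropertyTau_stdGauss (ι : Type*) [Fintype ι] :
    HasPropertyTau (stdGauss ι) fun x y => ∑ i, (x i - y i) ^ 2 / 4 := by
  have key : ∀ n, HasPropertyTau (stdGauss (Fin n)) fun x y => ∑ i, (x i - y i) ^ 2 / 4 := by
    intro n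
    induction n with
    | zero =>
      intro u v hu hv huv
      have e : ∀ w : (Fin 0 → ℝ) → ℝ≥0∞, ∫⁻ x, w x ∂(stdGauss (Fin 0)) = w 0 := fun w => by
        rw [stdGauss, Measure.pi_of_empty, lintegral_dirac]
        congr 1
        exact Subsingleton.elim _ _
      rw [e, e]
      simpa using huv 0 0
    | succ n ih =>
      refine (hasPropertyTau_gaussianReal.prod ih).of_measurePreserving
        (measurePreserving_piFinSuccAbove (fun _ : Fin (n + 1) => gaussianReal 0 1) 0).symm ?_
      intro x y
      rw [Fin.sum_univ_succ]
      simp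
  refine (key (Fintype.card ι)).of_measurePreserving
    (measurePreserving_piCongrLeft (fun _ : ι => gaussianReal 0 1) (Fintype.equivFin ι).symm) ?_
  intro x y
  rw [← (Fintype.equivFin ι).symm.sum_comp]
  simp only [MeasurableEquiv.coe_piCongrLeft, Equiv.piCongrLeft_apply_apply]

/-! ### Schur complements, pivots and positivity of the determinant -/

/-- The first Schur complement of an array. -/
noncomputable def schur (M : ℕ → ℕ → ℝ) : ℕ → ℕ → ℝ :=
  fun i j => M (i + 1) (j + 1) - M (i + 1) 0 * M 0 (j + 1) / M 0 0

/-- The bilinear form given by the upper left `n × n` block of `M` is positive definite. -/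
def PosForm (n : ℕ) (M : ℕ → ℕ → ℝ) : Prop :=
  ∀ x : Fin n → ℝ, x ≠ 0 → 0 < ∑ i : Fin n, ∑ j : Fin n, x i * M i j * x j

theorem PosForm.pivot_pos {n : ℕ} {M : ℕ → ℕ → ℝ} (h : PosForm (n + 1) M) : 0 < M 0 0 := by
  have := h (Pi.single 0 1) (by simp)
  simpa [Fin.sum_univ_succ] using this

/-- Prepend to y the coordinate c for which row zero of M annihilates (c, y); the form of M at (c,
y) is then the form of the Schur complement at y. No symmetry of M is needed. -/
theorem PosForm.schur {n : ℕ} {M : ℕ → ℕ → ℝ} (h : PosForm (n + 1) M) : PosForm n (schur M) := by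
  intro y hy
  have hp := h.pivot_pos
  set c := -(∑ j : Fin n, M 0 (j + 1) * y j) / M 0 0 with hc
  have := h (Fin.cons c y) (by
    contrapose! hy
    ext i
    simpa using congrFun hy i.succ)
  refine this.trans_eq ?_
  simp only [Fin.sum_univ_succ, Fin.cons_zero, Fin.cons_succ, Fin.val_zero, Fin.val_succ,
    MatchPoly.schur]
  have e1 : ∑ j : Fin n, c * M 0 (j + 1) * y j = c * ∑ j : Fin n, M 0 (j + 1) * y j := by
    rw [Finset.mul_sum]; simp only [mul_assoc]
  have e2 : c * M 0 0 * c + ∑ j : Fin n, c * M 0 (j + 1) * y j = 0 := by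
    rw [e1, hc]; field_simp; ring
  rw [e2, zero_add]
  refine Finset.sum_congr rfl fun i _ => ?_
  have e3 : y i * M (i + 1) 0 * c = ∑ j : Fin n, -(y i * (M (i + 1) 0 * M 0 (j + 1) / M 0 0) * y j) := by
    rw [hc, ← Finset.sum_neg_distrib, Finset.sum_div, Finset.mul_sum]
    refine Finset.sum_congr rfl fun j _ => ?_
    ring
  rw [e3, ← Finset.sum_add_distrib]
  refine Finset.sum_congr rfl fun j _ => ?_
  ring

theorem PosForm.iterate_schur {n p : ℕ} {M : ℕ → ℕ → ℝ} (h : PosForm n M) (hp : p ≤ n) :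
    PosForm (n - p) (MatchPoly.schur^[p] M) := by
  induction p generalizing n M with
  | zero => simpa
  | succ p ih =>
    obtain ⟨m, rfl⟩ : ∃ m, n = m + 1 := ⟨n - 1, by omega⟩
    rw [Function.iterate_succ_apply, show m + 1 - (p + 1) = m - p by omega]
    exact ih h.schur (by omega)

theorem PosForm.iterate_pivot_pos {n p : ℕ} {M : ℕ → ℕ → ℝ} (h : PosForm n M) (hp : p < n) :
    0 < (MatchPoly.schur^[p] M) 0 0 := by
  have := h.iterate_schur hp.le
  obtain ⟨m, hm⟩ : ∃ m, n - p = m + 1 := ⟨n - p - 1, by omega⟩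
  rw [hm] at this
  exact this.pivot_pos

theorem det_eq_pivot_mul_det_schur (n : ℕ) {M : ℕ → ℕ → ℝ} (h : M 0 0 ≠ 0) :
    (Matrix.of fun i j : Fin (n + 1) => M i j).det =
      M 0 0 * (Matrix.of fun i j : Fin n => schur M i j).det := by
  set B : Matrix (Fin (n + 1)) (Fin (n + 1)) ℝ :=
    Matrix.of fun i j => if i = 0 then M 0 j else M i j - M i 0 * M 0 j / M 0 0 with hB
  rw [Matrix.det_eq_of_forall_row_eq_smul_add_const (B := B)
    (fun i => if i = 0 then 0 else M i 0 / M 0 0) 0 (by simp)]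
  · rw [Matrix.det_succ_column_zero, Fin.sum_univ_succ, Finset.sum_eq_zero]
    · simp only [hB, Matrix.of_apply, Fin.val_zero, pow_zero, one_mul, if_true, add_zero]
      congr 2
    · intro i _
      have : B i.succ 0 = 0 := by
        simp [hB, h, Fin.succ_ne_zero]
      simp [this]
  · intro i j
    by_cases hi : i = 0
    · simp [hB, hi]
    · simp only [hB, hi, Matrix.of_apply, if_false, if_true]
      ring

theorem PosForm.det_eq_prod {n : ℕ} {M : ℕ → ℕ → ℝ} (h : PosForm n M) :
    (Matrix.of fun i j : Fin n => M i j).det =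
      ∏ p ∈ Finset.range n, (MatchPoly.schur^[p] M) 0 0 := by
  induction n generalizing M with
  | zero => simp
  | succ n ih =>
    rw [det_eq_pivot_mul_det_schur n h.pivot_pos.ne', ih h.schur, Finset.prod_range_succ']
    simp [mul_comm]

theorem PosForm.det_pos {n : ℕ} {M : ℕ → ℕ → ℝ} (h : PosForm n M) :
    0 < (Matrix.of fun i j : Fin n => M i j).det := by
  rw [h.det_eq_prod]
  exact Finset.prod_pos fun p hp => h.iterate_pivot_pos (Finset.mem_range.1 hp)

theorem PosForm.log_det {n : ℕ} {M : ℕ → ℕ → ℝ} (h : PosForm n M) :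
    Real.log (Matrix.of fun i j : Fin n => M i j).det =
      ∑ p ∈ Finset.range n, Real.log ((MatchPoly.schur^[p] M) 0 0) := by
  rw [h.det_eq_prod, Real.log_prod fun p hp => (h.iterate_pivot_pos (Finset.mem_range.1 hp)).ne']

theorem sum_skew_form {N : ℕ} {Y : Matrix (Fin N) (Fin N) ℝ} (hY : Yᵀ = -Y) (x : Fin N → ℝ) :
    ∑ i, ∑ j, x i * Y i j * x j = 0 := by
  have h : ∑ i, ∑ j, x i * Y i j * x j = -∑ i, ∑ j, x i * Y i j * x j := by
    conv_lhs => rw [Finset.sum_comm]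
    simp only [← Finset.sum_neg_distrib]
    refine Finset.sum_congr rfl fun i _ => Finset.sum_congr rfl fun j _ => ?_
    rw [skew_apply hY i j]
    ring
  linarith

/-- The skew part drops out of the form, leaving s |x|². The array is constrained only inside the N
× N block, so that arrays held in machine memory qualify. -/
theorem posForm_of_skew {N : ℕ} {Y : Matrix (Fin N) (Fin N) ℝ} (hY : Yᵀ = -Y) {s : ℝ}
    (hs : 0 < s) {M : ℕ → ℕ → ℝ}
    (hM : ∀ i j : Fin N, M i j = (s • (1 : Matrix (Fin N) (Fin N) ℝ) + Y) i j) :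
    PosForm N M := by
  intro x hx
  have : ∑ i : Fin N, ∑ j : Fin N, x i * M i j * x j = s * ∑ i, x i ^ 2 := by
    simp only [hM, Matrix.add_apply, Matrix.smul_apply, smul_eq_mul, mul_add, add_mul,
      Finset.sum_add_distrib, sum_skew_form hY, add_zero, Matrix.one_apply, mul_ite, ite_mul,
      mul_one, mul_zero, zero_mul, Finset.sum_ite_eq, Finset.mem_univ, if_true, Finset.mul_sum]
    exact Finset.sum_congr rfl fun i _ => by ring
  rw [this]
  refine mul_pos hs ?_
  obtain ⟨i, hi⟩ := Function.ne_iff.1 hx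
  exact Finset.sum_pos' (fun i _ => sq_nonneg _) ⟨i, Finset.mem_univ _, by
    have : x i ≠ 0 := hi
    positivity⟩

/-- A square matrix as an array indexed by the natural numbers. -/
noncomputable def toArray {N : ℕ} (M : Matrix (Fin N) (Fin N) ℝ) (i j : ℕ) : ℝ :=
  if h : i < N ∧ j < N then M ⟨i, h.1⟩ ⟨j, h.2⟩ else 0

@[simp] theorem toArray_val {N : ℕ} (M : Matrix (Fin N) (Fin N) ℝ) (i j : Fin N) :
    toArray M i j = M i j := by
  simp [toArray]

theorem det_smul_one_add_skew_pos {N : ℕ} {Y : Matrix (Fin N) (Fin N) ℝ} (hY : Yᵀ = -Y) {s : ℝ}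
    (hs : 0 < s) : 0 < (s • (1 : Matrix (Fin N) (Fin N) ℝ) + Y).det := by
  have := (posForm_of_skew hY hs (M := toArray (s • (1 : Matrix (Fin N) (Fin N) ℝ) + Y))
    (fun i j => toArray_val _ i j)).det_pos
  simp only [toArray_val] at this
  exact this

theorem Y_transpose {N : ℕ} {A : Matrix (Fin N) (Fin N) ℝ} (hA : Aᵀ = -A) (ξ : Sym2 (Fin N) → ℝ) :
    (Y A ξ)ᵀ = -Y A ξ := by
  ext i j
  simp [Y, skew_apply hA i j, Sym2.eq_swap (a := j) (b := i)]

theorem detY_pos {N : ℕ} {A : Matrix (Fin N) (Fin N) ℝ} (hA : Aᵀ = -A) {t : ℝ} (ht : 0 < t)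
    (ξ : Sym2 (Fin N) → ℝ) : 0 < detY A t ξ :=
  det_smul_one_add_skew_pos (Y_transpose hA ξ) (Real.sqrt_pos.2 ht)

/-! ### The Lipschitz bound for log det -/

/-- Factor out det M and use det(1 + τB) = 1 + τ tr B + τ² · (polynomial in τ) with B = M⁻¹H. -/
theorem hasDerivAt_log_det_line {N : ℕ} (M H : Matrix (Fin N) (Fin N) ℝ) (hM : M.det ≠ 0) :
    HasDerivAt (fun τ : ℝ => Real.log (M + τ • H).det) (M⁻¹ * H).trace 0 := by
  have hd : HasDerivAt (fun τ : ℝ => (M + τ • H).det) (M.det * (M⁻¹ * H).trace) 0 := by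
    have e : (fun τ : ℝ => (M + τ • H).det) = fun τ => M.det * (1 + τ • (M⁻¹ * H)).det := by
      ext τ
      rw [← Matrix.det_mul, mul_add, mul_one, mul_smul_comm, ← mul_assoc,
        Matrix.mul_nonsing_inv _ (isUnit_iff_ne_zero.2 hM), one_mul]
    rw [e]
    refine HasDerivAt.const_mul _ ?_
    have e2 := fun τ : ℝ => Matrix.det_one_add_smul τ (M⁻¹ * H)
    simp only [e2]
    have h1 := ((((hasDerivAt_id (0 : ℝ)).const_mul (M⁻¹ * H).trace).const_add 1).add
      (((Matrix.det (1 + (Polynomial.X : Polynomial ℝ) •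
        (M⁻¹ * H).map Polynomial.C)).divX.divX.hasDerivAt 0).mul (hasDerivAt_pow 2 (0 : ℝ))))
    refine (h1.congr_deriv ?_)
    simp
  have := hd.log (by simpa using hM)
  simpa [hM] using this

theorem sum_sq_eq_trace {N : ℕ} (C : Matrix (Fin N) (Fin N) ℝ) :
    ∑ p : Fin N × Fin N, C p.1 p.2 ^ 2 = (Cᵀ * C).trace := by
  rw [Fintype.sum_prod_type, Finset.sum_comm]
  simp [Matrix.trace, Matrix.mul_apply, pow_two]

theorem trace_mul_sq_le {N : ℕ} (C H : Matrix (Fin N) (Fin N) ℝ) :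
    (C * H).trace ^ 2 ≤ (∑ p : Fin N × Fin N, C p.1 p.2 ^ 2) * ∑ p : Fin N × Fin N, H p.1 p.2 ^ 2 := by
  have e : (C * H).trace = ∑ p : Fin N × Fin N, C p.1 p.2 * H p.2 p.1 := by
    rw [Fintype.sum_prod_type]
    simp [Matrix.trace, Matrix.mul_apply]
  have e2 : ∑ p : Fin N × Fin N, H p.1 p.2 ^ 2 = ∑ p : Fin N × Fin N, H p.2 p.1 ^ 2 := by
    rw [Fintype.sum_prod_type, Fintype.sum_prod_type, Finset.sum_comm]
  rw [e, e2]
  exact Finset.sum_mul_sq_le_sq_mul_sq _ _ _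

/-- The logarithmic derivative of the determinant at `s I + Y` in a skew-symmetric direction. -/
theorem trace_inv_mul_skew_sq_le {N : ℕ} {Y H : Matrix (Fin N) (Fin N) ℝ} (hY : Yᵀ = -Y)
    (hH : Hᵀ = -H) {s : ℝ} (hs : 0 < s) :
    ((s • (1 : Matrix (Fin N) (Fin N) ℝ) + Y)⁻¹ * H).trace ^ 2 ≤
      N / (4 * s ^ 2) * ∑ p : Fin N × Fin N, H p.1 p.2 ^ 2 := by
  set M := s • (1 : Matrix (Fin N) (Fin N) ℝ) + Y with hMdef
  have hM : IsUnit M.det := isUnit_iff_ne_zero.2 (det_smul_one_add_skew_pos hY hs).ne'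
  have hMt : Mᵀ = s • (1 : Matrix (Fin N) (Fin N) ℝ) - Y := by
    simp [hMdef, hY, sub_eq_add_neg]
  have hcomm : M * Mᵀ = Mᵀ * M := by
    rw [hMt, hMdef]
    simp only [mul_add, add_mul, mul_sub, sub_mul, smul_mul_assoc, mul_smul_comm, one_mul, mul_one, smul_add,
      smul_sub]
    abel
  -- This Cayley transform is orthogonal because M commutes with its transpose. Since M + Mᵀ = 2s I,
  -- it expresses 2s M⁻¹ as C + I, and the I is invisible in the trace against the traceless H.
  set C := Mᵀ * M⁻¹ with hC
  have hCC : Cᵀ * C = 1 := by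
    rw [hC, Matrix.transpose_mul, Matrix.transpose_transpose, mul_assoc, ← mul_assoc M, hcomm,
      mul_assoc Mᵀ, Matrix.mul_nonsing_inv _ hM, mul_one, ← Matrix.transpose_mul,
      Matrix.mul_nonsing_inv _ hM, Matrix.transpose_one]
  have hCI : (2 * s) • M⁻¹ = C + 1 := by
    rw [hC, ← Matrix.mul_nonsing_inv _ hM, ← add_mul, hMt, hMdef]
    rw [show s • (1 : Matrix (Fin N) (Fin N) ℝ) - Y + (s • 1 + Y) = (2 * s) • 1 by
      rw [two_mul, add_smul]; abel]
    rw [smul_mul_assoc, one_mul]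
  have hHtr : H.trace = 0 := by
    have := congrArg Matrix.trace hH
    rw [Matrix.trace_transpose, Matrix.trace_neg] at this
    linarith
  have htr : (2 * s) * (M⁻¹ * H).trace = (C * H).trace := by
    rw [← smul_eq_mul, ← Matrix.trace_smul, ← smul_mul_assoc, hCI, add_mul, one_mul,
      Matrix.trace_add, hHtr, add_zero]
  have hb := trace_mul_sq_le C H
  rw [sum_sq_eq_trace C, hCC, Matrix.trace_one, Fintype.card_fin, ← htr] at hb
  rw [div_mul_eq_mul_div, le_div_iff₀ (by positivity)]
  linarith

theorem sum_mk_le_two_mul_sum {N : ℕ} {g : Sym2 (Fin N) → ℝ} (hg : ∀ p, 0 ≤ g p) :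
    ∑ q : Fin N × Fin N, g s(q.1, q.2) ≤ 2 * ∑ p, g p := by
  classical
  rw [← Finset.sum_fiberwise (s := Finset.univ) (g := fun q : Fin N × Fin N => s(q.1, q.2)),
    Finset.mul_sum]
  refine Finset.sum_le_sum fun p _ => ?_
  rw [Finset.sum_congr rfl (g := fun _ => g p) (by intro q hq; rw [(Finset.mem_filter.1 hq).2]),
    Finset.sum_const, nsmul_eq_mul]
  refine mul_le_mul_of_nonneg_right ?_ (hg p)
  induction p with | _ a b =>
  have : (Finset.univ.filter fun q : Fin N × Fin N => s(q.1, q.2) = s(a, b)) ⊆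
      {(a, b), (b, a)} := by
    rintro ⟨c, d⟩ hq
    simpa [Prod.ext_iff] using hq
  exact_mod_cast (Finset.card_le_card this).trans Finset.card_le_two

theorem abs_le_maxAbs {N : ℕ} (A : Matrix (Fin N) (Fin N) ℝ) (i j : Fin N) :
    |A i j| ≤ maxAbs A :=
  le_ciSup (f := fun p : Fin N × Fin N => |A p.1 p.2|) (Set.finite_range _).bddAbove (i, j)

theorem maxAbs_pos {N : ℕ} {A : Matrix (Fin N) (Fin N) ℝ} (hA : A ≠ 0) : 0 < maxAbs A := by
  obtain ⟨i, j, h⟩ : ∃ i j, A i j ≠ 0 := by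
    contrapose! hA
    ext i j
    exact hA i j
  exact (abs_pos.2 h).trans_le (abs_le_maxAbs A i j)

theorem sum_Y_sq_le {N : ℕ} (A : Matrix (Fin N) (Fin N) ℝ) (ξ : Sym2 (Fin N) → ℝ) :
    ∑ p : Fin N × Fin N, Y A ξ p.1 p.2 ^ 2 ≤ 2 * maxAbs A ^ 2 * ∑ p, ξ p ^ 2 := by
  calc _ ≤ ∑ p : Fin N × Fin N, maxAbs A ^ 2 * ξ s(p.1, p.2) ^ 2 := by
        refine Finset.sum_le_sum fun p _ => ?_
        rw [Y, Matrix.of_apply, mul_pow]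
        refine mul_le_mul_of_nonneg_right ?_ (sq_nonneg _)
        rw [← sq_abs]
        exact pow_le_pow_left₀ (abs_nonneg _) (abs_le_maxAbs A _ _) 2
    _ ≤ _ := by
        rw [← Finset.mul_sum, mul_comm 2, mul_assoc]
        exact mul_le_mul_of_nonneg_left
          (sum_mk_le_two_mul_sum (g := fun p => ξ p ^ 2) fun p => sq_nonneg _) (sq_nonneg _)

/-- `log det (√t I + Y_A(ξ))` is a Lipschitz function of `ξ`. -/
theorem log_detY_lipschitz {N : ℕ} {A : Matrix (Fin N) (Fin N) ℝ} (hA : Aᵀ = -A) {t : ℝ}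
    (ht : 0 < t) (ξ η : Sym2 (Fin N) → ℝ) :
    (Real.log (detY A t ξ) - Real.log (detY A t η)) ^ 2 ≤
      maxAbs A ^ 2 * N / (2 * t) * ∑ p, (ξ p - η p) ^ 2 := by
  set B := maxAbs A ^ 2 * N / (2 * t) * ∑ p, (ξ p - η p) ^ 2 with hB
  have hB0 : 0 ≤ B := by
    have : 0 ≤ ∑ p, (ξ p - η p) ^ 2 := Finset.sum_nonneg fun p _ => sq_nonneg _
    positivity
  set s := Real.sqrt t with hs
  have hs0 : 0 < s := Real.sqrt_pos.2 ht
  set H := Y A (ξ - η) with hH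
  -- The mean value inequality is applied along the segment from η to ξ, where the direction of the
  -- matrix is constantly H.
  set Z : ℝ → Matrix (Fin N) (Fin N) ℝ := fun τ => Y A (η + τ • (ξ - η)) with hZ
  have hline : ∀ τ υ : ℝ, s • (1 : Matrix (Fin N) (Fin N) ℝ) + Z υ =
      (s • (1 : Matrix (Fin N) (Fin N) ℝ) + Z τ) + (υ - τ) • H := by
    intro τ υ
    ext i j
    simp only [hZ, hH, Y, Matrix.add_apply, Matrix.of_apply, Matrix.smul_apply, Pi.add_apply,
      Pi.smul_apply, Pi.sub_apply, smul_eq_mul]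
    ring
  set φ : ℝ → ℝ := fun τ => Real.log (s • (1 : Matrix (Fin N) (Fin N) ℝ) + Z τ).det with hφ
  have hder : ∀ τ, HasDerivAt φ
      ((s • (1 : Matrix (Fin N) (Fin N) ℝ) + Z τ)⁻¹ * H).trace τ := by
    intro τ
    have h1 := hasDerivAt_log_det_line (s • (1 : Matrix (Fin N) (Fin N) ℝ) + Z τ) H
      (det_smul_one_add_skew_pos (Y_transpose hA _) hs0).ne'
    have h2 := HasDerivAt.comp τ (h₂ := fun τ' : ℝ => Real.log
      ((s • (1 : Matrix (Fin N) (Fin N) ℝ) + Z τ) + τ' • H).det) (by simpa using h1)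
      ((hasDerivAt_id τ).sub_const τ)
    rw [mul_one] at h2
    refine h2.congr_of_eventuallyEq (.of_forall fun υ => ?_)
    simp only [hφ, Function.comp_apply, id]
    rw [hline τ υ]
  have hbound : ∀ τ, ‖((s • (1 : Matrix (Fin N) (Fin N) ℝ) + Z τ)⁻¹ * H).trace‖ ≤
      Real.sqrt B := by
    intro τ
    refine Real.abs_le_sqrt ((trace_inv_mul_skew_sq_le (Y_transpose hA _) (Y_transpose hA _)
      hs0).trans ?_)
    -- N/(4t) from the trace bound times 2a² from this one gives the constant a²N/(2t).
    have h3 := sum_Y_sq_le A (ξ - η)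
    rw [hs, Real.sq_sqrt ht.le, hB]
    refine (mul_le_mul_of_nonneg_left h3 (by positivity)).trans_eq ?_
    simp only [Pi.sub_apply]
    field_simp
    ring
  have key := Convex.norm_image_sub_le_of_norm_hasDerivWithin_le (s := Set.univ)
    (fun τ _ => (hder τ).hasDerivWithinAt) (fun τ _ => hbound τ) convex_univ
    (Set.mem_univ (0 : ℝ)) (Set.mem_univ 1)
  have e1 : φ 1 = Real.log (detY A t ξ) := by simp [hφ, hZ, detY, hs]
  have e0 : φ 0 = Real.log (detY A t η) := by simp [hφ, hZ, detY, hs]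
  rw [e1, e0, sub_zero, norm_one, mul_one, Real.norm_eq_abs] at key
  calc _ = |Real.log (detY A t ξ) - Real.log (detY A t η)| ^ 2 := (sq_abs _).symm
    _ ≤ Real.sqrt B ^ 2 := pow_le_pow_left₀ (abs_nonneg _) key 2
    _ = B := Real.sq_sqrt hB0

/-! ### Gaussian concentration for Lipschitz functions -/

section Concentration

variable {ι : Type*} [Fintype ι] {F : (ι → ℝ) → ℝ} {L : ℝ}

/-- Property (τ) for u = e^(-L-F) and v = e^F. With D = |x-y|², its hypothesis is F(y) - F(x) ≤ L +
D/4, which follows from (F(y) - F(x))² ≤ LD by AM–GM. -/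
theorem lintegral_exp_neg_mul_lintegral_exp_le (hF : Measurable F) (hL0 : 0 ≤ L)
    (hL : ∀ x y, (F x - F y) ^ 2 ≤ L * ∑ i, (x i - y i) ^ 2) :
    (∫⁻ x, ENNReal.ofReal (Real.exp (-F x)) ∂(stdGauss ι)) *
      ∫⁻ x, ENNReal.ofReal (Real.exp (F x)) ∂(stdGauss ι) ≤ ENNReal.ofReal (Real.exp L) := by
  have := hasPropertyTau_stdGauss ι (fun x => ENNReal.ofReal (Real.exp (-L)) *
    ENNReal.ofReal (Real.exp (-F x))) (fun x => ENNReal.ofReal (Real.exp (F x)))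
    (by fun_prop) (by fun_prop) fun x y => by
      rw [← ENNReal.ofReal_mul (Real.exp_pos _).le, ← ENNReal.ofReal_mul (by positivity),
        ← Real.exp_add, ← Real.exp_add]
      refine ENNReal.ofReal_le_ofReal (Real.exp_le_exp.2 ?_)
      simp only [← Finset.sum_div]
      have h := hL y x
      have hD : ∑ i, (y i - x i) ^ 2 = ∑ i, (x i - y i) ^ 2 :=
        Finset.sum_congr rfl fun i _ => by ring
      rw [hD] at h
      have hD0 : 0 ≤ ∑ i, (x i - y i) ^ 2 := Finset.sum_nonneg fun i _ => sq_nonneg _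
      set D := ∑ i, (x i - y i) ^ 2
      have := abs_le_of_sq_le_sq' (a := F y - F x) (b := L + D / 4)
        (by nlinarith [sq_nonneg (L - D / 4)]) (by positivity)
      linarith [this.2]
  rw [lintegral_const_mul _ (by fun_prop), mul_assoc, Real.exp_neg,
    ENNReal.ofReal_inv_of_pos (Real.exp_pos _), ENNReal.inv_mul_le_iff (by simp [Real.exp_pos])
    (by simp), mul_one] at this
  exact this

/-- The product with the strictly positive integral of e^(-F) is finite, so the integral of e^F
cannot be infinite. -/
theorem integrable_exp_of_lipschitz (hF : Measurable F) (hL0 : 0 ≤ L)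
    (hL : ∀ x y, (F x - F y) ^ 2 ≤ L * ∑ i, (x i - y i) ^ 2) :
    Integrable (fun x => Real.exp (F x)) (stdGauss ι) := by
  have h := lintegral_exp_neg_mul_lintegral_exp_le hF hL0 hL
  refine ⟨by fun_prop, ?_⟩
  rw [hasFiniteIntegral_iff_ofReal (.of_forall fun x => (Real.exp_pos _).le)]
  have hpos : 0 < ∫⁻ x, ENNReal.ofReal (Real.exp (-F x)) ∂(stdGauss ι) := by
    rw [lintegral_pos_iff_support (by fun_prop)]
    have : Function.support (fun x => ENNReal.ofReal (Real.exp (-F x))) = Set.univ := by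
      ext x; simp [Real.exp_pos]
    simp [this]
  by_contra hc
  rw [not_lt, top_le_iff] at hc
  rw [hc, ENNReal.mul_top hpos.ne'] at h
  simp at h

theorem integrable_of_lipschitz (hF : Measurable F) (hL0 : 0 ≤ L)
    (hL : ∀ x y, (F x - F y) ^ 2 ≤ L * ∑ i, (x i - y i) ^ 2) :
    Integrable F (stdGauss ι) := by
  have h1 := integrable_exp_of_lipschitz hF hL0 hL
  have h2 := integrable_exp_of_lipschitz (F := fun x => -F x) hF.neg hL0 fun x y => by
    rw [show (-F x - -F y) ^ 2 = (F x - F y) ^ 2 by ring]; exact hL x y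
  refine (h1.add h2).mono' hF.aestronglyMeasurable (.of_forall fun x => ?_)
  rw [Real.norm_eq_abs, Pi.add_apply]
  have e1 := Real.add_one_le_exp (F x)
  have e2 := Real.add_one_le_exp (-F x)
  have e3 := Real.exp_pos (F x)
  have e4 := Real.exp_pos (-F x)
  exact abs_le.2 ⟨by linarith, by linarith⟩

/-- The exponential moment bound for Lipschitz functions of Gaussian vectors. -/
theorem integral_exp_le_of_lipschitz (hF : Measurable F) (hL0 : 0 ≤ L)
    (hL : ∀ x y, (F x - F y) ^ 2 ≤ L * ∑ i, (x i - y i) ^ 2) :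
    ∫ x, Real.exp (F x) ∂(stdGauss ι) ≤ Real.exp (∫ x, F x ∂(stdGauss ι) + L) := by
  have hneg : ∀ x y, (-F x - -F y) ^ 2 ≤ L * ∑ i, (x i - y i) ^ 2 := fun x y => by
    rw [show (-F x - -F y) ^ 2 = (F x - F y) ^ 2 by ring]; exact hL x y
  have h1 := integrable_exp_of_lipschitz hF hL0 hL
  have h2 := integrable_exp_of_lipschitz (F := fun x => -F x) hF.neg hL0 hneg
  have h := lintegral_exp_neg_mul_lintegral_exp_le hF hL0 hL
  rw [← ofReal_integral_eq_lintegral_ofReal h1 (.of_forall fun x => (Real.exp_pos _).le),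
    ← ofReal_integral_eq_lintegral_ofReal h2 (.of_forall fun x => (Real.exp_pos _).le),
    ← ENNReal.ofReal_mul (integral_nonneg fun x => (Real.exp_pos _).le),
    ENNReal.ofReal_le_ofReal_iff (Real.exp_pos _).le] at h
  -- Jensen bounds E e^(-F) from below by e^(-EF), which moves that factor to the right-hand side.
  have hJ := convexOn_exp.map_integral_le Real.continuous_exp.continuousOn isClosed_univ (by simp)
    (integrable_of_lipschitz hF hL0 hL).neg h2
  simp only [Pi.neg_apply, integral_neg] at hJ
  have hI : 0 ≤ ∫ x, Real.exp (F x) ∂(stdGauss ι) := integral_nonneg fun x => (Real.exp_pos _).le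
  have h3 := (mul_le_mul_of_nonneg_right hJ hI).trans h
  rw [Real.exp_neg, inv_mul_le_iff₀ (Real.exp_pos _), ← Real.exp_add] at h3
  exact h3

theorem measure_integral_add_le_le_of_lipschitz (hF : Measurable F) (hL0 : 0 < L)
    (hL : ∀ x y, (F x - F y) ^ 2 ≤ L * ∑ i, (x i - y i) ^ 2) {r : ℝ} (hr : 0 ≤ r) :
    (stdGauss ι).real {x | ∫ y, F y ∂(stdGauss ι) + r ≤ F x} ≤ Real.exp (-r ^ 2 / (4 * L)) := by
  -- The minimiser of c²L - cr, the exponent in Chernoff's bound.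
  set c := r / (2 * L) with hc
  have hc0 : 0 ≤ c := by positivity
  have hcL : ∀ x y, (c * F x - c * F y) ^ 2 ≤ c ^ 2 * L * ∑ i, (x i - y i) ^ 2 := fun x y => by
    rw [← mul_sub, mul_pow, mul_assoc]
    exact mul_le_mul_of_nonneg_left (hL x y) (sq_nonneg _)
  have h1 := integrable_exp_of_lipschitz (F := fun x => c * F x) (hF.const_mul c) (by positivity) hcL
  have h2 := integral_exp_le_of_lipschitz (F := fun x => c * F x) (hF.const_mul c) (by positivity) hcL
  refine (measure_ge_le_exp_mul_mgf _ hc0 h1).trans ?_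
  rw [mgf]
  refine (mul_le_mul_of_nonneg_left h2 (Real.exp_pos _).le).trans ?_
  rw [integral_const_mul, ← Real.exp_add, Real.exp_le_exp, hc]
  apply le_of_eq
  field_simp
  ring

/-- Gaussian concentration for Lipschitz functions. -/
theorem measure_le_abs_sub_integral_le_of_lipschitz (hF : Measurable F) (hL0 : 0 < L)
    (hL : ∀ x y, (F x - F y) ^ 2 ≤ L * ∑ i, (x i - y i) ^ 2) {r : ℝ} (hr : 0 ≤ r) :
    (stdGauss ι).real {x | r ≤ |F x - ∫ y, F y ∂(stdGauss ι)|} ≤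
      2 * Real.exp (-r ^ 2 / (4 * L)) := by
  have h1 := measure_integral_add_le_le_of_lipschitz hF hL0 hL hr
  have h2 := measure_integral_add_le_le_of_lipschitz (F := fun x => -F x) hF.neg hL0
    (fun x y => by
      rw [show (-F x - -F y) ^ 2 = (F x - F y) ^ 2 by ring]; exact hL x y) hr
  refine (measureReal_mono (s₂ := {x | ∫ y, F y ∂(stdGauss ι) + r ≤ F x} ∪
    {x | ∫ y, -F y ∂(stdGauss ι) + r ≤ -F x}) ?_).trans ((measureReal_union_le _ _).trans ?_)
  · intro x hx
    rcases le_abs.1 (show r ≤ |F x - ∫ y, F y ∂(stdGauss ι)| from hx) with h | h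
    · left
      simp only [Set.mem_ofPred_eq]
      linarith
    · right
      simp only [Set.mem_ofPred_eq, integral_neg]
      linarith
  · linarith

end Concentration

/-! ### Independent copies and their means -/

theorem hasLaw_stdGauss_of_iIndepFun {ι Ω : Type*} [Fintype ι] [MeasurableSpace Ω] {P : Measure Ω}
    {X : ι → Ω → ℝ} (hX : ∀ i, HasLaw (X i) (gaussianReal 0 1) P) (hi : iIndepFun X P) :
    HasLaw (fun ω i => X i ω) (stdGauss ι) P := by
  refine ⟨aemeasurable_pi_lambda _ fun i => (hX i).aemeasurable, ?_⟩
  rw [hi.map_fun_eq_pi_map fun i => (hX i).aemeasurable, stdGauss]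
  congr 1
  ext1 i
  exact (hX i).map_eq

theorem hasLaw_comp_stdGauss {ι κ : Type*} [Fintype ι] [Fintype κ] {f : κ → ι}
    (hf : Function.Injective f) :
    HasLaw (fun (x : ι → ℝ) i => x (f i)) (stdGauss κ) (stdGauss ι) :=
  hasLaw_stdGauss_of_iIndepFun
    (fun i => ⟨(measurable_pi_apply _).aemeasurable, (measurePreserving_eval (fun _ : ι => gaussianReal 0 1) (f i)).map_eq⟩)
    ((iIndepFun_pi (X := fun _ x => x) fun _ => aemeasurable_id).precomp hf)

theorem hasLaw_comp_gaussianSamples {κ : Type*} [Fintype κ] {f : κ → ℕ}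
    (hf : Function.Injective f) :
    HasLaw (fun (x : ℕ → ℝ) i => x (f i)) (stdGauss κ) RealRAM.gaussianSamples :=
  hasLaw_stdGauss_of_iIndepFun
    (fun i => ⟨(measurable_pi_apply _).aemeasurable,
      (measurePreserving_eval_infinitePi (fun _ : ℕ => gaussianReal 0 1) (f i)).map_eq⟩)
    ((iIndepFun_infinitePi (X := fun _ x => x) fun _ => measurable_id).precomp hf)

instance : IsProbabilityMeasure RealRAM.gaussianSamples := by
  unfold RealRAM.gaussianSamples; infer_instance

theorem HasLaw.real_preimage {Ω α : Type*} [MeasurableSpace Ω] [MeasurableSpace α] {P : Measure Ω}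
    {μ : Measure α} {X : Ω → α} (h : HasLaw X μ P) {s : Set α} (hs : MeasurableSet s) :
    P.real (X ⁻¹' s) = μ.real s := by
  rw [← h.map_eq, measureReal_def, measureReal_def, Measure.map_apply_of_aemeasurable
    h.aemeasurable hs]

/-- Gaussian concentration for the mean of independent copies of a Lipschitz function. -/
theorem measure_le_abs_mean_sub_integral_le {κ : Type*} [Fintype κ] {F : (κ → ℝ) → ℝ} {L : ℝ}
    (hF : Measurable F) (hL0 : 0 < L)
    (hL : ∀ x y, (F x - F y) ^ 2 ≤ L * ∑ i, (x i - y i) ^ 2) {k : ℕ} (hk : 1 ≤ k)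
    {Ω : Type*} [MeasurableSpace Ω] {P : Measure Ω} {X : Ω → Fin k × κ → ℝ}
    (hX : HasLaw X (stdGauss (Fin k × κ)) P) {r : ℝ} (hr : 0 ≤ r) :
    P.real {ω | r ≤ |(1 / (k : ℝ)) * ∑ l, F (fun p => X ω (l, p)) - ∫ x, F x ∂(stdGauss κ)|} ≤
      2 * Real.exp (-k * r ^ 2 / (4 * L)) := by
  have hk0 : (0 : ℝ) < k := by exact_mod_cast hk
  set G : (Fin k × κ → ℝ) → ℝ := fun x => (1 / (k : ℝ)) * ∑ l, F (fun p => x (l, p)) with hG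
  have hGm : Measurable G := by
    refine (Finset.measurable_sum _ fun l _ => hF.comp ?_).const_mul _
    fun_prop
  -- Cauchy–Schwarz over the k blocks: averaging divides the squared Lipschitz constant by k.
  have hGL : ∀ x y, (G x - G y) ^ 2 ≤ L / k * ∑ i, (x i - y i) ^ 2 := by
    intro x y
    simp only [hG]
    rw [← mul_sub, ← Finset.sum_sub_distrib, mul_pow, Fintype.sum_prod_type]
    have h1 := sq_sum_le_card_mul_sum_sq (s := Finset.univ)
      (f := fun l : Fin k => F (fun p => x (l, p)) - F (fun p => y (l, p)))
    have h2 : ∑ l : Fin k, (F (fun p => x (l, p)) - F (fun p => y (l, p))) ^ 2 ≤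
        L * ∑ l : Fin k, ∑ p, (x (l, p) - y (l, p)) ^ 2 := by
      rw [Finset.mul_sum]
      exact Finset.sum_le_sum fun l _ => hL _ _
    rw [Finset.card_univ, Fintype.card_fin] at h1
    have h3 := h1.trans (mul_le_mul_of_nonneg_left h2 hk0.le)
    refine (mul_le_mul_of_nonneg_left h3 (sq_nonneg _)).trans_eq ?_
    field_simp
  have hint : ∫ x, G x ∂(stdGauss (Fin k × κ)) = ∫ x, F x ∂(stdGauss κ) := by
    have hl : ∀ l : Fin k, HasLaw (fun (x : Fin k × κ → ℝ) p => x (l, p)) (stdGauss κ)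
        (stdGauss (Fin k × κ)) := fun l =>
      hasLaw_comp_stdGauss (f := fun p => (l, p)) (Prod.mk_right_injective l)
    have hFi := integrable_of_lipschitz hF hL0.le hL
    have he : ∀ l : Fin k, ∫ x, F (fun p => x (l, p)) ∂(stdGauss (Fin k × κ)) =
        ∫ x, F x ∂(stdGauss κ) := fun l =>
      (hl l).integral_comp hF.aestronglyMeasurable
    simp only [hG]
    rw [integral_const_mul, integral_finsetSum]
    · simp only [he, Finset.sum_const, Finset.card_univ, Fintype.card_fin, nsmul_eq_mul]
      field_simp
    · intro l _
      have := (hl l).map_eq ▸ hFi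
      exact this.comp_aemeasurable (hl l).aemeasurable
  have key := measure_le_abs_sub_integral_le_of_lipschitz hGm (div_pos hL0 hk0) hGL hr
  rw [hint, ← HasLaw.real_preimage hX (measurableSet_le measurable_const (by fun_prop))] at key
  refine key.trans_eq ?_
  congr 2
  field_simp

/-! ### Concentration and moment bounds for log det (√t I + Y_A) -/

section DetY

variable {N : ℕ} {A : Matrix (Fin N) (Fin N) ℝ} {t : ℝ}

theorem measurable_detY (A : Matrix (Fin N) (Fin N) ℝ) (t : ℝ) : Measurable (detY A t) := by
  unfold detY
  simp only [Matrix.det_apply]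
  refine Finset.measurable_sum _ fun σ _ => ?_
  refine Measurable.const_smul (Finset.measurable_prod _ fun i _ => ?_) _
  simp only [Y, Matrix.add_apply, Matrix.of_apply]
  fun_prop

theorem gaussianEntries_eq (N : ℕ) : gaussianEntries N = stdGauss (Sym2 (Fin N)) := rfl

theorem integrable_log_detY (hA : Aᵀ = -A) (ht : 0 < t) :
    Integrable (fun ξ => Real.log (detY A t ξ)) (gaussianEntries N) :=
  integrable_of_lipschitz (measurable_detY A t).log (by positivity) (log_detY_lipschitz hA ht)

theorem integrable_detY (hA : Aᵀ = -A) (ht : 0 < t) :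
    Integrable (fun ξ => detY A t ξ) (gaussianEntries N) := by
  have := integrable_exp_of_lipschitz (measurable_detY A t).log (by positivity)
    (log_detY_lipschitz hA ht)
  simpa only [Real.exp_log (detY_pos hA ht _), gaussianEntries_eq] using this

theorem logPhiTilde_le_log_integral (hA : Aᵀ = -A) (ht : 0 < t) :
    logPhiTilde A t ≤ Real.log (∫ ξ, detY A t ξ ∂(gaussianEntries N)) := by
  have : IsProbabilityMeasure (gaussianEntries N) := by
    rw [gaussianEntries_eq]; infer_instance
  have h1 := integrable_log_detY hA ht
  have h2 := integrable_detY hA ht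
  have hJ := convexOn_exp.map_integral_le Real.continuous_exp.continuousOn isClosed_univ (by simp)
    h1 (by simpa only [Function.comp_def, Real.exp_log (detY_pos hA ht _)] using h2)
  simp only [Real.exp_log (detY_pos hA ht _)] at hJ
  rw [logPhiTilde]
  exact (Real.le_log_iff_exp_le ((Real.exp_pos _).trans_le hJ)).2 hJ

theorem log_integral_detY_le (hA : Aᵀ = -A) (ht : 0 < t) :
    Real.log (∫ ξ, detY A t ξ ∂(gaussianEntries N)) ≤
      logPhiTilde A t + maxAbs A ^ 2 * N / (2 * t) := by
  have h := integral_exp_le_of_lipschitz (measurable_detY A t).log (by positivity)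
    (log_detY_lipschitz hA ht)
  simp only [Real.exp_log (detY_pos hA ht _), ← gaussianEntries_eq] at h
  have h0 := integral_exp_pos (integrable_exp_of_lipschitz (measurable_detY A t).log (by positivity)
    (log_detY_lipschitz hA ht))
  simp only [Real.exp_log (detY_pos hA ht _), ← gaussianEntries_eq] at h0
  exact (Real.log_le_iff_le_exp h0).2 h

theorem mean_log_detY_concentration (hA : Aᵀ = -A) (hA0 : A ≠ 0) (ht : 0 < t) {k : ℕ} (hk : 1 ≤ k)
    {Ω : Type*} [MeasurableSpace Ω] {P : Measure Ω} {X : Ω → Fin k × Sym2 (Fin N) → ℝ}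
    (hX : HasLaw X (stdGauss (Fin k × Sym2 (Fin N))) P) {r : ℝ} (hr : 0 ≤ r) :
    P.real {ω | N * r ≤
        |(1 / (k : ℝ)) * ∑ l, Real.log (detY A t fun p => X ω (l, p)) - logPhiTilde A t|} ≤
      2 * Real.exp (-(t * k * N * r ^ 2) / (2 * maxAbs A ^ 2)) := by
  have ha := maxAbs_pos hA0
  have hN : (0 : ℝ) < N := by
    rcases N.eq_zero_or_pos with rfl | h
    · exact absurd (Subsingleton.elim _ _) hA0
    · exact_mod_cast h
  -- With L = a²N/(2t) and deviation Nr, the exponent k(Nr)²/(4L) is tkNr²/(2a²).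
  refine (measure_le_abs_mean_sub_integral_le (measurable_detY A t).log (by positivity)
    (log_detY_lipschitz hA ht) hk hX (mul_nonneg hN.le hr)).trans_eq ?_
  congr 2
  field_simp
  ring

end DetY


/-! ### Moments of a standard Gaussian -/

theorem integrable_pow_gaussianReal (n : ℕ) :
    Integrable (fun x : ℝ => x ^ n) (gaussianReal 0 1) :=
  integrable_pow_of_mem_interior_integrableExpSet (X := fun x => x)
    (by rw [integrableExpSet_fun_id_gaussianReal]; simp) n

theorem integrable_polynomial_gaussianReal (P : Polynomial ℝ) :
    Integrable (fun x : ℝ => P.eval x) (gaussianReal 0 1) := by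
  simp only [Polynomial.eval_eq_sum_range]
  exact integrable_finsetSum _ fun n _ => (integrable_pow_gaussianReal n).const_mul _

theorem integrable_prod_linear_gaussianReal {ι : Type*} (S : Finset ι) (c d : ι → ℝ) :
    Integrable (fun x : ℝ => ∏ i ∈ S, (c i + d i * x)) (gaussianReal 0 1) := by
  have := integrable_polynomial_gaussianReal
    (∏ i ∈ S, (Polynomial.C (c i) + Polynomial.C (d i) * Polynomial.X))
  simpa [Polynomial.eval_prod] using this

theorem integral_sq_gaussianReal : ∫ x : ℝ, x ^ 2 ∂(gaussianReal 0 1) = 1 := by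
  have h := variance_fun_id_gaussianReal (μ := 0) (v := 1)
  rw [variance_of_integral_eq_zero (by fun_prop) (by simp)] at h
  simpa using h

/-! ### Involutions and matchings of the complete graph -/

section Permutations

variable {V : Type*}

theorem mk_eq_mk_iff_of_involution {σ : Equiv.Perm V} (hσ : ∀ i, σ (σ i) = i) {i j : V} :
    s(σ j, j) = s(σ i, i) ↔ j = i ∨ j = σ i := by
  rw [Sym2.eq_iff]
  constructor
  · rintro (⟨_, h⟩ | ⟨_, h⟩)
    · exact Or.inl h
    · exact Or.inr h
  · rintro (rfl | rfl)
    · simp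
    · simp [hσ]

open Classical in
/-- The vertex matched with `i`, or `i` if there is none. -/
noncomputable def partner (M : Finset (Sym2 V)) (i : V) : V :=
  if h : ∃ j, s(i, j) ∈ M then h.choose else i

theorem IsMatching.right_unique {G : SimpleGraph V} {M : Finset (Sym2 V)} (hM : IsMatching G M)
    {i j k : V} (hj : s(i, j) ∈ M) (hk : s(i, k) ∈ M) : j = k := by
  by_contra h
  exact hM.2 _ hj _ hk (fun e => h (Sym2.congr_right.1 e)) i ⟨by simp, by simp⟩

theorem IsMatching.partner_eq {G : SimpleGraph V} {M : Finset (Sym2 V)} (hM : IsMatching G M)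
    {i j : V} (hj : s(i, j) ∈ M) : partner M i = j := by
  have h : ∃ j, s(i, j) ∈ M := ⟨j, hj⟩
  rw [partner, dif_pos h]
  exact hM.right_unique h.choose_spec hj

theorem partner_of_forall_notMem {M : Finset (Sym2 V)} {i : V} (h : ∀ j, s(i, j) ∉ M) :
    partner M i = i := by
  rw [partner, dif_neg (by simpa using h)]

theorem IsMatching.partner_partner {G : SimpleGraph V} {M : Finset (Sym2 V)}
    (hM : IsMatching G M) (i : V) : partner M (partner M i) = i := by
  by_cases h : ∃ j, s(i, j) ∈ M
  · obtain ⟨j, hj⟩ := h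
    rw [hM.partner_eq hj, hM.partner_eq (Sym2.eq_swap ▸ hj)]
  · push Not at h
    rw [partner_of_forall_notMem h, partner_of_forall_notMem h]

variable [DecidableEq V] [Fintype V]

/-- The set of the two-element orbits of an involution. -/
def orbitEdges (σ : Equiv.Perm V) : Finset (Sym2 V) :=
  σ.support.image fun i => s(σ i, i)

theorem isMatching_orbitEdges {σ : Equiv.Perm V} (hσ : ∀ i, σ (σ i) = i) :
    IsMatching ⊤ (orbitEdges σ) := by
  constructor
  · intro e he
    obtain ⟨i, hi, rfl⟩ := Finset.mem_image.1 he
    simpa using hi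
  · intro e he f hf hef v hv
    obtain ⟨i, hi, rfl⟩ := Finset.mem_image.1 he
    obtain ⟨j, hj, rfl⟩ := Finset.mem_image.1 hf
    apply hef
    have key : ∀ k, v ∈ s(σ k, k) → s(σ k, k) = s(σ v, v) := by
      intro k hk
      rw [mk_eq_mk_iff_of_involution hσ]
      rcases Sym2.mem_iff.1 hk with rfl | rfl
      · right; rw [hσ]
      · left; rfl
    rw [key i hv.1, key j hv.2]

theorem mk_mem_orbitEdges_iff {σ : Equiv.Perm V} (hσ : ∀ i, σ (σ i) = i) {i j : V} :
    s(i, j) ∈ orbitEdges σ ↔ σ i = j ∧ i ≠ j := by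
  simp only [orbitEdges, Finset.mem_image, Equiv.Perm.mem_support]
  constructor
  · rintro ⟨k, hk, h⟩
    rcases Sym2.eq_iff.1 h with ⟨rfl, rfl⟩ | ⟨rfl, rfl⟩
    · exact ⟨hσ _, hk⟩
    · exact ⟨rfl, hk.symm⟩
  · rintro ⟨rfl, h⟩
    exact ⟨i, h.symm, Sym2.eq_swap⟩

theorem two_mul_card_orbitEdges {σ : Equiv.Perm V} (hσ : ∀ i, σ (σ i) = i) :
    2 * (orbitEdges σ).card = σ.support.card := by
  rw [Finset.card_eq_sum_card_image (fun i => s(σ i, i)) σ.support, Finset.sum_const_nat (m := 2),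
    mul_comm, orbitEdges]
  intro e he
  obtain ⟨i, hi, rfl⟩ := Finset.mem_image.1 he
  have : σ.support.filter (fun j => s(σ j, j) = s(σ i, i)) = {i, σ i} := by
    ext j
    simp only [Finset.mem_filter, mk_eq_mk_iff_of_involution hσ, Finset.mem_insert,
      Finset.mem_singleton, and_iff_right_iff_imp]
    rintro (rfl | rfl)
    · exact hi
    · simpa [hσ, eq_comm] using hi
  rw [this, Finset.card_pair]
  exact (Equiv.Perm.mem_support.1 hi).symm

theorem partner_orbitEdges {σ : Equiv.Perm V} (hσ : ∀ i, σ (σ i) = i) (i : V) :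
    partner (orbitEdges σ) i = σ i := by
  by_cases h : σ i = i
  · rw [h, partner_of_forall_notMem]
    intro j hj
    rw [mk_mem_orbitEdges_iff hσ] at hj
    exact hj.2 (h.symm.trans hj.1)
  · exact (isMatching_orbitEdges hσ).partner_eq ((mk_mem_orbitEdges_iff hσ).2 ⟨rfl, Ne.symm h⟩)

/-- The map exchanging matched vertices and fixing the others is an involution; this inverts
`orbitEdges`. -/
theorem exists_orbitEdges_eq {M : Finset (Sym2 V)} (hM : IsMatching ⊤ M) :
    ∃ σ : Equiv.Perm V, (∀ i, σ (σ i) = i) ∧ orbitEdges σ = M := by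
  have hinv : Function.Involutive (partner M) := hM.partner_partner
  refine ⟨hinv.toPerm, hinv, ?_⟩
  ext e
  induction e with | _ i j =>
  rw [mk_mem_orbitEdges_iff (σ := hinv.toPerm) hinv]
  change partner M i = j ∧ i ≠ j ↔ _
  constructor
  · rintro ⟨rfl, h⟩
    by_cases hc : ∃ j, s(i, j) ∈ M
    · obtain ⟨j, hj⟩ := hc
      rwa [hM.partner_eq hj]
    · push Not at hc
      exact absurd (partner_of_forall_notMem hc).symm h
  · intro h
    exact ⟨hM.partner_eq h, by simpa using hM.1 _ h⟩

end Permutations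

/-! ### The expected determinant as a matching polynomial -/

section ExpectedDeterminant

variable {N : ℕ} {A : Matrix (Fin N) (Fin N) ℝ}

/-- The columns in which the term of `σ` in a determinant uses the variable of the index pair `p`. -/
def entryFiber (σ : Equiv.Perm (Fin N)) (p : Sym2 (Fin N)) : Finset (Fin N) :=
  Finset.univ.filter fun i => s(σ i, i) = p

theorem prod_term_eq (σ : Equiv.Perm (Fin N)) (s : ℝ) (ξ : Sym2 (Fin N) → ℝ) :
    ∏ i, (s • (1 : Matrix (Fin N) (Fin N) ℝ) + Y A ξ) (σ i) i =
      ∏ p, ∏ i ∈ entryFiber σ p,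
        ((s • (1 : Matrix (Fin N) (Fin N) ℝ)) (σ i) i + A (σ i) i * ξ p) := by
  rw [← Finset.prod_fiberwise (s := Finset.univ) (g := fun i => s(σ i, i))]
  refine Finset.prod_congr rfl fun p _ => Finset.prod_congr rfl fun i hi => ?_
  rw [← (Finset.mem_filter.1 hi).2]
  rfl

theorem integrable_prod_term (σ : Equiv.Perm (Fin N)) (s : ℝ) :
    Integrable (fun ξ => ∏ i, (s • (1 : Matrix (Fin N) (Fin N) ℝ) + Y A ξ) (σ i) i)
      (gaussianEntries N) := by
  simp only [prod_term_eq]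
  exact Integrable.fintype_prod fun p => integrable_prod_linear_gaussianReal _ _ _

theorem integral_prod_term (σ : Equiv.Perm (Fin N)) (s : ℝ) :
    ∫ ξ, ∏ i, (s • (1 : Matrix (Fin N) (Fin N) ℝ) + Y A ξ) (σ i) i ∂(gaussianEntries N) =
      ∏ p, ∫ x, ∏ i ∈ entryFiber σ p,
        ((s • (1 : Matrix (Fin N) (Fin N) ℝ)) (σ i) i + A (σ i) i * x) ∂(gaussianReal 0 1) := by
  simp only [prod_term_eq]
  exact integral_fintype_prod_eq_prod (fun p x => ∏ i ∈ entryFiber σ p,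
        ((s • (1 : Matrix (Fin N) (Fin N) ℝ)) (σ i) i + A (σ i) i * x))

/-- The variable of the pair {σ i₀, i₀} enters the term only through column i₀. The entry there is
off the diagonal, so it is a multiple of a centred variable. -/
theorem integral_prod_term_eq_zero {σ : Equiv.Perm (Fin N)} {s : ℝ} {i₀ : Fin N}
    (h : σ (σ i₀) ≠ i₀) :
    ∫ ξ, ∏ i, (s • (1 : Matrix (Fin N) (Fin N) ℝ) + Y A ξ) (σ i) i ∂(gaussianEntries N) = 0 := by
  rw [integral_prod_term]
  refine Finset.prod_eq_zero (Finset.mem_univ s(σ i₀, i₀)) ?_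
  have hf : entryFiber σ s(σ i₀, i₀) = {i₀} := by
    ext j
    simp only [entryFiber, Finset.mem_filter, Finset.mem_univ, true_and, Finset.mem_singleton,
      Sym2.eq_iff]
    constructor
    · rintro (⟨_, h'⟩ | ⟨h1, rfl⟩)
      · exact h'
      · exact absurd h1 h
    · rintro rfl
      exact Or.inl ⟨rfl, rfl⟩
  have h0 : σ i₀ ≠ i₀ := fun e => h (by rw [e, e])
  simp only [hf, Finset.prod_singleton, Matrix.smul_apply, Matrix.one_apply_ne h0, smul_zero,
    zero_add]
  rw [integral_const_mul, integral_id_gaussianReal, mul_zero]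

/-- At a fixed point a_ii = 0 leaves the diagonal entry s; on a two-element orbit the factor is a_ij
a_ji E x², negative by skew symmetry. -/
theorem integral_fiber_of_involution (hA : Aᵀ = -A) {σ : Equiv.Perm (Fin N)}
    (hσ : ∀ i, σ (σ i) = i) (s : ℝ) (i : Fin N) :
    ∫ x, ∏ j ∈ entryFiber σ s(σ i, i),
        ((s • (1 : Matrix (Fin N) (Fin N) ℝ)) (σ j) j + A (σ j) j * x) ∂(gaussianReal 0 1) =
      if σ i = i then s else -weightOf A hA s(σ i, i) := by
  have hf : entryFiber σ s(σ i, i) = {i, σ i} := by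
    ext j
    simp [entryFiber, mk_eq_mk_iff_of_involution hσ]
  rw [hf]
  split_ifs with h
  · have hd : A i i = 0 := by have := skew_apply hA i i; linarith
    simp [h, hd, Matrix.one_apply]
  · have e : ∀ x : ℝ, ∏ j ∈ {i, σ i}, ((s • (1 : Matrix (Fin N) (Fin N) ℝ)) (σ j) j +
        A (σ j) j * x) = -(|A (σ i) i| ^ 2) * x ^ 2 := by
      intro x
      rw [Finset.prod_pair (Ne.symm h), hσ, skew_apply hA (σ i) i, sq_abs]
      simp only [Matrix.smul_apply, Matrix.one_apply_ne h, Matrix.one_apply_ne (Ne.symm h)]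
      simp only [smul_zero]
      ring
    simp only [e]
    rw [integral_const_mul, integral_sq_gaussianReal, mul_one]
    rfl

theorem integral_prod_term_of_involution (hA : Aᵀ = -A) {σ : Equiv.Perm (Fin N)}
    (hσ : ∀ i, σ (σ i) = i) (s : ℝ) :
    ∫ ξ, ∏ i, (s • (1 : Matrix (Fin N) (Fin N) ℝ) + Y A ξ) (σ i) i ∂(gaussianEntries N) =
      s ^ (N - 2 * (orbitEdges σ).card) * ∏ e ∈ orbitEdges σ, -weightOf A hA e := by
  rw [integral_prod_term]
  have hsub : ∀ p ∉ Finset.univ.image (fun i => s(σ i, i)),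
      ∫ x, ∏ j ∈ entryFiber σ p, ((s • (1 : Matrix (Fin N) (Fin N) ℝ)) (σ j) j +
        A (σ j) j * x) ∂(gaussianReal 0 1) = 1 := by
    intro p hp
    have : entryFiber σ p = ∅ := by
      ext i
      simp only [entryFiber, Finset.mem_filter, Finset.notMem_empty, iff_false]
      rintro ⟨_, rfl⟩
      exact hp (Finset.mem_image_of_mem _ (Finset.mem_univ i))
    simp [this]
  rw [← Finset.prod_subset (Finset.subset_univ (Finset.univ.image (fun i => s(σ i, i))))
    fun p _ hp => hsub p hp]
  have hsplit : Finset.univ.image (fun i => s(σ i, i)) =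
      σ.supportᶜ.image (fun i => s(σ i, i)) ∪ orbitEdges σ := by
    rw [orbitEdges, ← Finset.image_union, Finset.union_comm, Finset.union_compl]
  have hfix : ∀ i, i ∈ σ.supportᶜ ↔ σ i = i := by simp
  have hdisj : Disjoint (σ.supportᶜ.image (fun i => s(σ i, i))) (orbitEdges σ) := by
    rw [Finset.disjoint_left]
    intro e he
    obtain ⟨i, hi, rfl⟩ := Finset.mem_image.1 he
    rw [mk_mem_orbitEdges_iff hσ]
    rintro ⟨_, h⟩
    exact h ((hfix i).1 hi)
  rw [hsplit, Finset.prod_union hdisj]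
  congr 1
  · rw [Finset.prod_image]
    · rw [Finset.prod_congr rfl (g := fun _ => s)]
      · rw [Finset.prod_const, Finset.card_compl, two_mul_card_orbitEdges hσ, Fintype.card_fin]
      · intro i hi
        rw [integral_fiber_of_involution hA hσ, if_pos ((hfix i).1 hi)]
    · intro i hi j hj h
      rcases (mk_eq_mk_iff_of_involution hσ).1 h with h | h
      · exact h
      · rw [h, (hfix j).1 hj]
  · refine Finset.prod_congr rfl fun e he => ?_
    obtain ⟨i, hi, rfl⟩ := Finset.mem_image.1 he
    rw [integral_fiber_of_involution hA hσ, if_neg (Equiv.Perm.mem_support.1 hi)]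

/-- An involution with k transpositions has sign (-1)^k, which cancels the k minus signs of the
weights. -/
theorem sign_mul_integral_prod_term (hA : Aᵀ = -A) {σ : Equiv.Perm (Fin N)}
    (hσ : ∀ i, σ (σ i) = i) (s : ℝ) :
    ((Equiv.Perm.sign σ : ℤ) : ℝ) *
      ∫ ξ, ∏ i, (s • (1 : Matrix (Fin N) (Fin N) ℝ) + Y A ξ) (σ i) i ∂(gaussianEntries N) =
      s ^ (N - 2 * (orbitEdges σ).card) * ∏ e ∈ orbitEdges σ, weightOf A hA e := by
  have h2 : σ ^ 2 = 1 := by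
    ext i
    simp [pow_two, hσ]
  have hle : σ.support.card ≤ Fintype.card (Fin N) := Finset.card_le_univ _
  rw [integral_prod_term_of_involution hA hσ, Equiv.Perm.sign_of_pow_two_eq_one h2,
    Equiv.Perm.card_fixedPoints, Equiv.Perm.sum_cycleType, Nat.sub_sub_self hle, ← two_mul_card_orbitEdges hσ, Nat.mul_div_cancel_left _ two_pos, Finset.prod_neg]
  push_cast
  rw [mul_left_comm, ← mul_assoc ((-1 : ℝ) ^ _), ← mul_pow]
  simp

open Classical in
theorem integral_detY (hA : Aᵀ = -A) (t : ℝ) :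
    ∫ ξ, detY A t ξ ∂(gaussianEntries N) =
      ∑ M ∈ Finset.univ.filter (fun M => IsMatching (graphOf A hA) M),
        Real.sqrt t ^ (N - 2 * M.card) * ∏ e ∈ M, weightOf A hA e := by
  unfold detY
  simp only [Matrix.det_apply']
  rw [integral_finsetSum _ fun σ _ => (integrable_prod_term σ _).const_mul _]
  simp only [integral_const_mul]
  rw [← Finset.sum_subset (Finset.subset_univ
    (Finset.univ.filter fun σ : Equiv.Perm (Fin N) => ∀ i, σ (σ i) = i))]
  swap
  · intro σ _ hσ
    simp only [Finset.mem_filter, Finset.mem_univ, true_and, not_forall] at hσ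
    obtain ⟨i, hi⟩ := hσ
    rw [integral_prod_term_eq_zero hi, mul_zero]
  -- Matchings of the complete graph that use a non-edge of `graphOf A hA` have weight zero, so the
  -- sum may be extended to all of them and then matched with the involutions.
  have hsub : (Finset.univ.filter fun M => IsMatching (graphOf A hA) M) ⊆
      Finset.univ.filter fun M => IsMatching (⊤ : SimpleGraph (Fin N)) M := by
    intro M hM
    simp only [Finset.mem_filter, Finset.mem_univ, true_and] at hM ⊢
    exact ⟨fun e he => SimpleGraph.edgeSet_mono le_top (hM.1 e he), hM.2⟩
  rw [Finset.sum_subset hsub]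
  swap
  · intro M hM hM'
    simp only [Finset.mem_filter, Finset.mem_univ, true_and] at hM hM'
    obtain ⟨e, he, hne⟩ : ∃ e ∈ M, e ∉ (graphOf A hA).edgeSet := by
      by_contra! h
      exact hM' ⟨h, hM.2⟩
    rw [Finset.prod_eq_zero he, mul_zero]
    induction e with | _ i j =>
    have : A i j = 0 := by simpa [graphOf] using hne
    simp [weightOf, this]
  refine Finset.sum_bij (fun σ _ => orbitEdges σ) ?_ ?_ ?_ ?_
  · intro σ hσ
    simp only [Finset.mem_filter, Finset.mem_univ, true_and] at hσ ⊢
    exact isMatching_orbitEdges hσ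
  · intro σ hσ τ hτ h
    simp only [Finset.mem_filter, Finset.mem_univ, true_and] at hσ hτ
    ext i
    rw [← partner_orbitEdges hσ, ← partner_orbitEdges hτ, h]
  · intro M hM
    obtain ⟨σ, hσ, rfl⟩ := exists_orbitEdges_eq (Finset.mem_filter.1 hM).2
    exact ⟨σ, by simpa using hσ, rfl⟩
  · intro σ hσ
    simp only [Finset.mem_filter, Finset.mem_univ, true_and] at hσ
    exact sign_mul_integral_prod_term hA hσ _

theorem IsMatching.two_mul_card_le {G : SimpleGraph (Fin N)} {M : Finset (Sym2 (Fin N))}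
    (hM : IsMatching G M) : 2 * M.card ≤ N := by
  obtain ⟨σ, hσ, rfl⟩ := exists_orbitEdges_eq (M := M)
    ⟨fun e he => SimpleGraph.edgeSet_mono le_top (hM.1 e he), hM.2⟩
  rw [two_mul_card_orbitEdges hσ]
  exact (Finset.card_le_univ _).trans_eq (Fintype.card_fin N)

/-- The expected determinant is the weighted matching polynomial, times `√t` if `N` is odd. -/
theorem integral_detY_eq_Phi (hA : Aᵀ = -A) {t : ℝ} (ht : 0 ≤ t) :
    ∫ ξ, detY A t ξ ∂(gaussianEntries N) = Real.sqrt t ^ (N % 2) * Phi A hA t := by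
  classical
  rw [integral_detY hA, Phi, matchingPolynomial, Fintype.card_fin, Finset.mul_sum,
    ← Finset.sum_fiberwise_of_maps_to (g := Finset.card) (t := Finset.range (N / 2 + 1))]
  · refine Finset.sum_congr rfl fun k hk => ?_
    have hk' : k ≤ N / 2 := Nat.lt_succ_iff.1 (Finset.mem_range.1 hk)
    rw [totalWeight, mul_comm (∑ M ∈ kMatchings _ _, _), ← mul_assoc, Finset.mul_sum, kMatchings,
      Finset.filter_filter]
    refine Finset.sum_congr (by congr) fun M hM => ?_
    have hMk : M.card = k := (Finset.mem_filter.1 hM).2.2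
    rw [hMk, show N - 2 * k = N % 2 + 2 * (N / 2 - k) by omega, pow_add, pow_mul, Real.sq_sqrt ht]
  · intro M hM
    have := (Finset.mem_filter.1 hM).2.two_mul_card_le
    rw [Finset.mem_range]
    omega

end ExpectedDeterminant

end MatchPoly

/-! ### Hoare-style rules with step counts -/

namespace RealRAM

/-- Assignment to an index register. -/
def State.setIdx (σ : State) (r v : ℕ) : State := { σ with idx := Function.update σ.idx r v }

/-- Assignment to a memory cell. -/
def State.setMem (σ : State) (m : ℕ) (v : ℝ) : State :=
  { σ with mem := Function.update σ.mem m v }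

/-- Assignment to a memory cell, together with an advance in the sequence of samples. -/
def State.draw (σ : State) (m : ℕ) (v : ℝ) : State :=
  { σ with mem := Function.update σ.mem m v, pos := σ.pos + 1 }

/-- Started in `σ`, the program halts within `c` steps in a state satisfying `Q`. -/
def Runs (x : ℕ → ℝ) (p : Program) (σ : State) (c : ℕ) (Q : State → Prop) : Prop :=
  ∃ s τ, Exec x p σ s τ ∧ s ≤ c ∧ Q τ

variable {x : ℕ → ℝ} {p q : Program} {σ : State} {c c' : ℕ} {Q R : State → Prop}

theorem Runs.mono (h : Runs x p σ c Q) (hc : c ≤ c') (hQ : ∀ τ, Q τ → R τ) : Runs x p σ c' R := by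
  obtain ⟨s, τ, he, hs, hq⟩ := h
  exact ⟨s, τ, he, hs.trans hc, hQ τ hq⟩

theorem Runs.skip (hQ : Q σ) (hc : 1 ≤ c) : Runs x .skip σ c Q :=
  ⟨_, _, .skip σ, hc, hQ⟩

theorem Runs.setIdx {r : ℕ} {e : IdxExp} (hQ : Q (σ.setIdx r (e.eval σ))) (hc : e.cost + 1 ≤ c) :
    Runs x (.setIdx r e) σ c Q :=
  ⟨_, _, .setIdx r e σ, hc, hQ⟩

theorem Runs.write {addr : IdxExp} {e : RealExp} (hl : e.Legal σ)
    (hQ : Q (σ.setMem (addr.eval σ) (e.eval σ))) (hc : addr.cost + e.cost + 1 ≤ c) :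
    Runs x (.write addr e) σ c Q :=
  ⟨_, _, .write addr e σ hl, hc, hQ⟩

theorem Runs.sample {addr : IdxExp} (hQ : Q (σ.draw (addr.eval σ) (x σ.pos)))
    (hc : addr.cost + 1 ≤ c) : Runs x (.sample addr) σ c Q :=
  ⟨_, _, .sample addr σ, hc, hQ⟩

theorem Runs.seq (h : Runs x p σ c fun τ => Runs x q τ c' Q) : Runs x (.seq p q) σ (c + c') Q := by
  obtain ⟨s, τ, he, hs, s', υ, he', hs', hq⟩ := h
  exact ⟨_, υ, .seq he he', add_le_add hs hs', hq⟩

theorem Runs.ite {b : Test} (hl : b.Legal σ) (h1 : b.Holds σ → Runs x p σ c Q)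
    (h2 : ¬ b.Holds σ → Runs x q σ c Q) : Runs x (.ite b p q) σ (b.cost + c) Q := by
  by_cases hb : b.Holds σ
  · obtain ⟨s, τ, he, hs, hq⟩ := h1 hb
    exact ⟨_, τ, .ite_true hl hb he, by omega, hq⟩
  · obtain ⟨s, τ, he, hs, hq⟩ := h2 hb
    exact ⟨_, τ, .ite_false hl hb he, by omega, hq⟩

/-- The invariant is indexed by the round, and under it the test is equivalent to i < n; hence there
are exactly n - a rounds and termination comes for free. -/
theorem Runs.loop {b : Test} {Inv : ℕ → State → Prop} {a n : ℕ}
    (hl : ∀ i σ, Inv i σ → b.Legal σ)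
    (hb : ∀ i σ, i ≤ n → Inv i σ → (b.Holds σ ↔ i < n))
    (hbody : ∀ i σ, a ≤ i → i < n → Inv i σ → Runs x p σ c (Inv (i + 1)))
    (ha : a ≤ n) (h0 : Inv a σ) :
    Runs x (.loop b p) σ ((n - a) * (b.cost + c) + b.cost) (Inv n) := by
  have key : ∀ d i σ, i + d = n → a ≤ i → Inv i σ →
      Runs x (.loop b p) σ (d * (b.cost + c) + b.cost) (Inv n) := by
    intro d
    induction d with
    | zero =>
      intro i σ hi _ hinv
      obtain rfl : i = n := by omega
      exact ⟨_, σ, .loop_false (hl _ _ hinv) (by rw [hb _ _ le_rfl hinv]; omega), by omega, hinv⟩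
    | succ d ih =>
      intro i σ hi hai hinv
      obtain ⟨s, τ, he, hs, hq⟩ := hbody i σ hai (by omega) hinv
      obtain ⟨s', υ, he', hs', hq'⟩ := ih (i + 1) τ (by omega) (by omega) hq
      refine ⟨_, υ, .loop_true (hl _ _ hinv) ((hb _ _ (by omega) hinv).2 (by omega)) he he', ?_, hq'⟩
      rw [Nat.succ_mul]
      omega
  exact key (n - a) a σ (by omega) le_rfl h0

/-- `for r := lo, lo + 1, …` while `r` is less than register `0`. -/
def forLoop (r : ℕ) (lo : IdxExp) (p : Program) : Program :=
  .seq (.setIdx r lo) (.loop (.idxLt (.reg r) (.reg 0))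
    (.seq p (.setIdx r (.add (.reg r) (.const 1)))))

/-- Each round costs c + 7, for the test, the body and the increment. The initial assignment and the
final test cost at most 9, absorbed into the n rounds because n ≥ 1. The frame condition lets the
rule itself keep track of the loop register. -/
theorem Runs.forLoop {r : ℕ} {lo : IdxExp} {Inv : ℕ → State → Prop} {n : ℕ} (hr : r ≠ 0)
    (hlo : lo.cost ≤ 5) (hn : 1 ≤ n) (hσ : σ.idx 0 = n) (hlon : lo.eval σ ≤ n)
    (hframe : ∀ i v τ, Inv i τ → Inv i (τ.setIdx r v)) (h0 : Inv (lo.eval σ) σ)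
    (hbody : ∀ i τ, lo.eval σ ≤ i → i < n → Inv i τ → τ.idx r = i → τ.idx 0 = n →
      Runs x p τ c fun υ => Inv (i + 1) υ ∧ υ.idx r = i ∧ υ.idx 0 = n) :
    Runs x (RealRAM.forLoop r lo p) σ (n * (c + 16)) (Inv n) := by
  have key := Runs.seq (x := x) (p := .setIdx r lo) (σ := σ)
    (q := .loop (.idxLt (.reg r) (.reg 0)) (.seq p (.setIdx r (.add (.reg r) (.const 1)))))
    (Q := Inv n) (Runs.setIdx (r := r) (e := lo) (Runs.mono (Runs.loop (x := x)
      (Inv := fun i τ => Inv i τ ∧ τ.idx r = i ∧ τ.idx 0 = n) (n := n) (a := lo.eval σ)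
      (c := c + 4) (fun _ _ _ => trivial) ?_ ?_ hlon ?_) le_rfl fun τ h => h.1) le_rfl)
  · refine key.mono ?_ fun τ h => h
    simp only [Test.cost, IdxExp.cost]
    have h1 : (n - lo.eval σ) * (1 + 1 + 1 + (c + 4)) ≤ n * (1 + 1 + 1 + (c + 4)) :=
      Nat.mul_le_mul_right _ (Nat.sub_le _ _)
    have h2 : n * (c + 16) = n * (1 + 1 + 1 + (c + 4)) + n * 9 := by ring
    omega
  · rintro i τ _ ⟨_, h1, h2⟩
    simp only [Test.Holds, IdxExp.eval, h1, h2]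
  · rintro i τ hai hin ⟨hi, h1, h2⟩
    refine Runs.seq ((hbody i τ hai hin hi h1 h2).mono le_rfl ?_)
    rintro υ ⟨hi', h1', h2'⟩
    refine Runs.setIdx ⟨?_, ?_, ?_⟩ (by simp [IdxExp.cost])
    · exact hframe _ _ _ hi'
    · simp [State.setIdx, IdxExp.eval, h1']
    · simpa [State.setIdx, Function.update_of_ne hr.symm] using h2'
  · refine ⟨hframe _ _ _ h0, ?_, ?_⟩
    · simp [State.setIdx]
    · simpa [State.setIdx, Function.update_of_ne hr.symm] using hσ

end RealRAM

/-! ### Memory layout and the effect of single assignments -/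

namespace MatchPoly

open RealRAM

/-- The address of the entry `(i, j)` of the work array. -/
def workAddr (N i j : ℕ) : ℕ := 3 + N * N + (i * N + j)

theorem index_lt {N i j : ℕ} (hi : i < N) (hj : j < N) : i * N + j < N * N := by
  have := Nat.mul_le_mul_right N (Nat.succ_le_of_lt hi)
  rw [Nat.succ_mul] at this
  omega

theorem index_inj {N i j i' j' : ℕ} (hj : j < N) (hj' : j' < N) (h : i * N + j = i' * N + j') :
    i = i' ∧ j = j' := by
  have hN : 0 < N := by omega
  have h1 : (i * N + j) / N = i := by
    rw [mul_comm, Nat.mul_add_div hN, Nat.div_eq_of_lt hj, add_zero]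
  have h2 : (i' * N + j') / N = i' := by
    rw [mul_comm, Nat.mul_add_div hN, Nat.div_eq_of_lt hj', add_zero]
  have h3 : i = i' := by rw [← h1, ← h2, h]
  subst h3
  exact ⟨rfl, by omega⟩

/-- The array `W` with one entry replaced. -/
def updateEntry (W : ℕ → ℕ → ℝ) (i j : ℕ) (v : ℝ) (i' j' : ℕ) : ℝ :=
  if i' = i ∧ j' = j then v else W i' j'

/-- What the memory holds: the matrix `A`, the work array `W`, and the first three cells. Register
`4` counts the determinants computed so far. -/
structure Holds (N : ℕ) (A : ℕ → ℕ → ℝ) (t : ℝ) (σ : State) (S K : ℝ) (W : ℕ → ℕ → ℝ)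
    (l pos : ℕ) : Prop where
  size : σ.idx 0 = N
  count : σ.idx 4 = l
  pos_eq : σ.pos = pos
  cell_zero : σ.mem 0 = t
  cell_one : σ.mem 1 = S
  cell_two : σ.mem 2 = K
  matrix : ∀ i j, i < N → j < N → σ.mem (3 + (i * N + j)) = A i j
  work : ∀ i j, i < N → j < N → σ.mem (workAddr N i j) = W i j

namespace Holds

variable {N : ℕ} {A : ℕ → ℕ → ℝ} {t : ℝ} {σ : State} {S K : ℝ} {W : ℕ → ℕ → ℝ} {l pos : ℕ}

theorem setIdx (h : Holds N A t σ S K W l pos) {r : ℕ} (v : ℕ) (h0 : r ≠ 0) (h4 : r ≠ 4) :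
    Holds N A t (σ.setIdx r v) S K W l pos where
  size := by simpa [State.setIdx, Function.update_of_ne h0.symm] using h.size
  count := by simpa [State.setIdx, Function.update_of_ne h4.symm] using h.count
  pos_eq := h.pos_eq
  cell_zero := h.cell_zero
  cell_one := h.cell_one
  cell_two := h.cell_two
  matrix := h.matrix
  work := h.work

theorem setCount (h : Holds N A t σ S K W l pos) (v : ℕ) :
    Holds N A t (σ.setIdx 4 v) S K W v pos where
  size := by simpa [State.setIdx] using h.size
  count := by simp [State.setIdx]
  pos_eq := h.pos_eq
  cell_zero := h.cell_zero
  cell_one := h.cell_one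
  cell_two := h.cell_two
  matrix := h.matrix
  work := h.work

theorem setWork (h : Holds N A t σ S K W l pos) {i j : ℕ} (hj : j < N) (v : ℝ) :
    Holds N A t (σ.setMem (workAddr N i j) v) S K (updateEntry W i j v) l pos where
  size := h.size
  count := h.count
  pos_eq := h.pos_eq
  cell_zero := by
    rw [← h.cell_zero]; exact Function.update_of_ne (by unfold workAddr; omega) _ _
  cell_one := by
    rw [← h.cell_one]; exact Function.update_of_ne (by unfold workAddr; omega) _ _
  cell_two := by
    rw [← h.cell_two]; exact Function.update_of_ne (by unfold workAddr; omega) _ _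
  matrix i' j' hi' hj' := by
    rw [← h.matrix i' j' hi' hj']
    have := index_lt hi' hj'
    exact Function.update_of_ne (by unfold workAddr; omega) _ _
  work i' j' hi' hj' := by
    unfold updateEntry
    split_ifs with he
    · rw [he.1, he.2]
      exact Function.update_self _ _ _
    · rw [← h.work i' j' hi' hj']
      refine Function.update_of_ne (fun e => he ?_) _ _
      unfold workAddr at e
      exact index_inj hj' hj (by omega)

theorem drawWork (h : Holds N A t σ S K W l pos) {i j : ℕ} (hj : j < N) (v : ℝ) :
    Holds N A t (σ.draw (workAddr N i j) v) S K (updateEntry W i j v) l (pos + 1) where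
  size := h.size
  count := h.count
  pos_eq := congrArg (· + 1) h.pos_eq
  cell_zero := (h.setWork hj v).cell_zero
  cell_one := (h.setWork hj v).cell_one
  cell_two := (h.setWork hj v).cell_two
  matrix := (h.setWork hj v).matrix
  work := (h.setWork hj v).work

theorem setCellOne (h : Holds N A t σ S K W l pos) (v : ℝ) :
    Holds N A t (σ.setMem 1 v) v K W l pos where
  size := h.size
  count := h.count
  pos_eq := h.pos_eq
  cell_zero := by simpa [State.setMem] using h.cell_zero
  cell_one := by simp [State.setMem]
  cell_two := by simpa [State.setMem] using h.cell_two
  matrix i j hi hj := by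
    rw [← h.matrix i j hi hj]; exact Function.update_of_ne (by omega) _ _
  work i j hi hj := by
    rw [← h.work i j hi hj]; exact Function.update_of_ne (by unfold workAddr; omega) _ _

theorem setCellTwo (h : Holds N A t σ S K W l pos) (v : ℝ) :
    Holds N A t (σ.setMem 2 v) S v W l pos where
  size := h.size
  count := h.count
  pos_eq := h.pos_eq
  cell_zero := by simpa [State.setMem] using h.cell_zero
  cell_one := by simpa [State.setMem] using h.cell_one
  cell_two := by simp [State.setMem]
  matrix i j hi hj := by
    rw [← h.matrix i j hi hj]; exact Function.update_of_ne (by omega) _ _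
  work i j hi hj := by
    rw [← h.work i j hi hj]; exact Function.update_of_ne (by unfold workAddr; omega) _ _

theorem congr_work (h : Holds N A t σ S K W l pos) {W' : ℕ → ℕ → ℝ}
    (hW : ∀ i j, i < N → j < N → W i j = W' i j) : Holds N A t σ S K W' l pos :=
  { h with work := fun i j hi hj => (h.work i j hi hj).trans (hW i j hi hj) }

end Holds

/-- The address of the work entry whose indices are in registers `r` and `r'`. -/
def workExp (r r' : ℕ) : IdxExp :=
  .add (.add (.const 3) (.mul (.reg 0) (.reg 0))) (.add (.mul (.reg r) (.reg 0)) (.reg r'))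

/-- The address of the entry of the input matrix whose indices are in registers `r` and `r'`. -/
def matrixExp (r r' : ℕ) : IdxExp :=
  .add (.const 3) (.add (.mul (.reg r) (.reg 0)) (.reg r'))

section Eval

variable {N : ℕ} {A : ℕ → ℕ → ℝ} {t : ℝ} {σ : State} {S K : ℝ} {W : ℕ → ℕ → ℝ} {l pos : ℕ}

theorem Holds.eval_workExp (h : Holds N A t σ S K W l pos) {r r' i j : ℕ} (hi : σ.idx r = i)
    (hj : σ.idx r' = j) : (workExp r r').eval σ = workAddr N i j := by
  simp only [workExp, IdxExp.eval, h.size, hi, hj, workAddr]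

theorem Holds.eval_read_work (h : Holds N A t σ S K W l pos) {r r' i j : ℕ} (hi : σ.idx r = i)
    (hj : σ.idx r' = j) (hiN : i < N) (hjN : j < N) :
    (RealExp.read (workExp r r')).eval σ = W i j := by
  rw [RealExp.eval, h.eval_workExp hi hj, h.work i j hiN hjN]

theorem Holds.eval_read_matrix (h : Holds N A t σ S K W l pos) {r r' i j : ℕ} (hi : σ.idx r = i)
    (hj : σ.idx r' = j) (hiN : i < N) (hjN : j < N) :
    (RealExp.read (matrixExp r r')).eval σ = A i j := by
  simp only [RealExp.eval, matrixExp, IdxExp.eval, h.size, hi, hj]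
  exact h.matrix i j hiN hjN

end Eval

/-! ### Filling the matrix with samples -/

/-- Filling in the entry `(i, j)` of `√t I + Y_A(ξ)`. -/
def fillEntry : Program :=
  .seq (.sample (workExp 1 2))
    (.ite (.idxLt (.reg 2) (.reg 1))
      (.write (workExp 1 2) (.sub (.ofIdx (.const 0)) (.read (workExp 2 1))))
      (.ite (.idxLt (.reg 1) (.reg 2))
        (.write (workExp 1 2) (.mul (.read (matrixExp 1 2)) (.read (workExp 1 2))))
        (.write (workExp 1 2) (.sqrt (.read (.const 0))))))

/-- Filling the work array with `√t I + Y_A(ξ)`. -/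
def fillMatrix : Program := forLoop 1 (.const 0) (forLoop 2 (.const 0) fillEntry)

/-- The array `√t I + Y_A(ξ)`, for the samples from position `pos` on. -/
noncomputable def sampledArray (N : ℕ) (A : ℕ → ℕ → ℝ) (t : ℝ) (x : ℕ → ℝ) (pos i j : ℕ) : ℝ :=
  if j < i then -(A j i * x (pos + (j * N + i)))
  else if i < j then A i j * x (pos + (i * N + j)) else Real.sqrt t

theorem runs_fillMatrix {N : ℕ} {A : ℕ → ℕ → ℝ} {t : ℝ} {σ : State} {S K : ℝ} {W : ℕ → ℕ → ℝ}
    {l pos : ℕ} (x : ℕ → ℝ) (ht : 0 ≤ t) (hN : 1 ≤ N) (h : Holds N A t σ S K W l pos) :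
    Runs x fillMatrix σ (N * (N * (100 + 16) + 16)) fun τ =>
      Holds N A t τ S K (sampledArray N A t x pos) l (pos + N * N) := by
  set M := sampledArray N A t x pos with hM
  -- Every entry consumes a sample, used or not, so the sample position depends only on the entry
  -- and the number of matrices already filled.
  refine Runs.mono (Runs.forLoop (Inv := fun i τ => ∃ W', Holds N A t τ S K W' l (pos + i * N) ∧
    ∀ i' j', i' < i → j' < N → W' i' j' = M i' j') (by omega) (by simp [IdxExp.cost]) hN h.size
    (Nat.zero_le _) ?_ ?_ ?_) le_rfl ?_
  · rintro i v τ ⟨W', h1, h2⟩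
    exact ⟨W', h1.setIdx v (by omega) (by omega), h2⟩
  · exact ⟨W, by simpa [IdxExp.eval] using h, fun i' j' hi' => by simp [IdxExp.eval] at hi'⟩
  · rintro i τ - hi ⟨W', hW', hW''⟩ hτi hτN
    refine Runs.mono (Runs.forLoop (Inv := fun j υ => (∃ W', Holds N A t υ S K W' l
      (pos + (i * N + j)) ∧ ∀ i' j', (i' < i ∨ i' = i ∧ j' < j) → j' < N → W' i' j' = M i' j') ∧
      υ.idx 1 = i) (by omega) (by simp [IdxExp.cost]) hN hτN (Nat.zero_le _) ?_ ?_ ?_) le_rfl ?_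
    · rintro j v υ ⟨⟨W', h1, h2⟩, h3⟩
      exact ⟨⟨W', h1.setIdx v (by omega) (by omega), h2⟩, by simpa [State.setIdx] using h3⟩
    · exact ⟨⟨W', by simpa [IdxExp.eval] using hW', fun i' j' hi' hj' => hW'' i' j'
        (by simpa [IdxExp.eval] using hi') hj'⟩, hτi⟩
    · rintro j υ - hj ⟨⟨V, hV, hVM⟩, hυ1⟩ hυ2 hυN
      unfold fillEntry
      refine Runs.mono (Runs.seq (c := 12) (Runs.sample ?_ (by simp [workExp, IdxExp.cost])))
        (c := 12 + (3 + (3 + 50))) (by omega) fun τ h => h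
      rw [hV.eval_workExp hυ1 hυ2, hV.pos_eq]
      have hD := hV.drawWork (i := i) hj (x (pos + (i * N + j)))
      set υ' := υ.draw (workAddr N i j) (x (pos + (i * N + j)))
      have e1 : υ'.idx 1 = i := hυ1
      have e2 : υ'.idx 2 = j := hυ2
      have fin : ∀ v, v = M i j → ∀ τ, τ = υ'.setMem (workAddr N i j) v →
          ((∃ W', Holds N A t τ S K W' l (pos + (i * N + (j + 1))) ∧
            ∀ i' j', (i' < i ∨ i' = i ∧ j' < j + 1) → j' < N → W' i' j' = M i' j') ∧
            τ.idx 1 = i) ∧ τ.idx 2 = j ∧ τ.idx 0 = N := by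
        rintro v hv τ rfl
        refine ⟨⟨⟨_, hD.setWork (i := i) hj v, ?_⟩, e1⟩, e2, hD.size⟩
        intro i' j' hij hj'
        unfold updateEntry
        split_ifs with he
        · rw [hv, he.1, he.2]
        · exact hVM i' j' (by omega) hj'
      refine Runs.ite trivial ?_ ?_
      · intro hlt
        simp only [Test.Holds, IdxExp.eval, e1, e2] at hlt
        refine Runs.write ⟨trivial, trivial⟩ (fin _ ?_ _ (by rw [hD.eval_workExp e1 e2]))
          (by simp [workExp, IdxExp.cost, RealExp.cost])
        -- Below the diagonal the fresh sample is overwritten by the negative of the mirror entry,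
        -- whose row j < i is already complete.
        rw [RealExp.eval, hD.eval_read_work e2 e1 hj hi, updateEntry, if_neg (by omega),
          hVM j i (by omega) hi, hM, sampledArray, sampledArray, if_pos hlt, if_neg (by omega),
          if_pos hlt]
        simp [RealExp.eval, IdxExp.eval]
      · intro hlt
        simp only [Test.Holds, IdxExp.eval, e1, e2] at hlt
        refine Runs.ite trivial ?_ ?_
        · intro hlt'
          simp only [Test.Holds, IdxExp.eval, e1, e2] at hlt'
          refine Runs.write ⟨trivial, trivial⟩ (fin _ ?_ _ (by rw [hD.eval_workExp e1 e2]))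
            (by simp [workExp, matrixExp, IdxExp.cost, RealExp.cost])
          rw [RealExp.eval, hD.eval_read_work e1 e2 hi hj, hD.eval_read_matrix e1 e2 hi hj,
            updateEntry, if_pos ⟨rfl, rfl⟩, hM, sampledArray, if_neg hlt, if_pos hlt']
        · intro hlt'
          simp only [Test.Holds, IdxExp.eval, e1, e2] at hlt'
          have hc : (RealExp.read (.const 0)).eval υ' = t := hD.cell_zero
          refine Runs.write ⟨trivial, by rw [hc]; exact ht⟩
            (fin _ ?_ _ (by rw [hD.eval_workExp e1 e2]))
            (by simp [workExp, IdxExp.cost, RealExp.cost])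
          rw [RealExp.eval, hc, hM, sampledArray, if_neg hlt, if_neg hlt']
    · rintro υ ⟨⟨V, hV, hVM⟩, hυ1⟩
      refine ⟨⟨V, ?_, fun i' j' hi' hj' => hVM i' j' (by omega) hj'⟩, hυ1, hV.size⟩
      rw [Nat.succ_mul]
      exact hV
  · rintro τ ⟨W', h1, h2⟩
    exact h1.congr_work h2

/-! ### Gaussian elimination without pivoting -/

/-- The elimination step for one entry; register `3` holds the index of the pivot. -/
def eliminateEntry : Program :=
  .write (workExp 1 2) (.sub (.read (workExp 1 2))
    (.div (.mul (.read (workExp 1 3)) (.read (workExp 3 2))) (.read (workExp 3 3))))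

/-- The replacement of the lower right block by its Schur complement. -/
def eliminateBlock : Program :=
  forLoop 1 (.add (.reg 3) (.const 1)) (forLoop 2 (.add (.reg 3) (.const 1)) eliminateEntry)

/-- Gaussian elimination without pivoting, adding the logarithms of the pivots to cell `1`. -/
def eliminate : Program :=
  forLoop 3 (.const 0) (.seq (.write (.const 1) (.add (.read (.const 1)) (.log (.read (workExp 3 3)))))
    eliminateBlock)

section Eliminate

variable {N : ℕ} {A : ℕ → ℕ → ℝ} {t : ℝ} {σ : State} {S K : ℝ} {W : ℕ → ℕ → ℝ} {l pos p : ℕ}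

/-- The array `W` in the course of the elimination with pivot `p`, before the entry `(i, j)`. -/
noncomputable def partialSchur (W : ℕ → ℕ → ℝ) (p i j i' j' : ℕ) : ℝ :=
  if p < i' ∧ p < j' ∧ (i' < i ∨ i' = i ∧ j' < j) then
    W i' j' - W i' p * W p j' / W p p else W i' j'

/-- Updating in place is harmless: only entries with both indices beyond p change, so row p and
column p, which every update reads, keep their original values. -/
theorem runs_eliminateBlock (x : ℕ → ℝ) (hp : p < N) (hW : W p p ≠ 0)
    (h : Holds N A t σ S K W l pos) (h3 : σ.idx 3 = p) :
    Runs x eliminateBlock σ (N * (N * (70 + 16) + 16)) fun τ =>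
      Holds N A t τ S K (partialSchur W p N 0) l pos ∧ τ.idx 3 = p := by
  have hlo : ∀ τ : State, τ.idx 3 = p → (IdxExp.add (.reg 3) (.const 1)).eval τ = p + 1 := by
    intro τ hτ
    simp [IdxExp.eval, hτ]
  refine Runs.mono (Runs.forLoop (Inv := fun i τ => Holds N A t τ S K (partialSchur W p i 0) l pos ∧
    τ.idx 3 = p) (by omega) (by simp [IdxExp.cost]) (by omega) h.size (by rw [hlo σ h3]; omega)
    ?_ ?_ ?_) le_rfl fun τ h => h
  · rintro i v τ ⟨h1, h2⟩
    exact ⟨h1.setIdx v (by omega) (by omega), by simpa [State.setIdx] using h2⟩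
  · refine ⟨h.congr_work fun i j _ _ => ?_, h3⟩
    rw [partialSchur, hlo σ h3, if_neg (by omega)]
  · rintro i τ hpi hi ⟨hV, hτ3⟩ hτi hτN
    rw [hlo σ h3] at hpi
    refine Runs.mono (Runs.forLoop (Inv := fun j υ => Holds N A t υ S K (partialSchur W p i j) l pos ∧
      υ.idx 3 = p ∧ υ.idx 1 = i) (by omega) (by simp [IdxExp.cost]) (by omega) hτN
      (by rw [hlo τ hτ3]; omega) ?_ ?_ ?_) le_rfl ?_
    · rintro j v υ ⟨h1, h2, h3⟩
      exact ⟨h1.setIdx v (by omega) (by omega), by simpa [State.setIdx] using h2,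
        by simpa [State.setIdx] using h3⟩
    · refine ⟨hV.congr_work fun i' j' _ _ => ?_, hτ3, hτi⟩
      simp only [partialSchur, hlo τ hτ3]
      congr 1
      rw [eq_iff_iff]
      omega
    · rintro j υ hpj hj ⟨hU, hυ3, hυ1⟩ hυ2 hυN
      rw [hlo τ hτ3] at hpj
      have hpp : partialSchur W p i j p p = W p p := by rw [partialSchur, if_neg (by omega)]
      refine Runs.write ⟨trivial, ⟨trivial, trivial⟩, trivial, ?_⟩ ⟨⟨?_, hυ3, hυ1⟩, hυ2, hυN⟩
        (by simp [workExp, IdxExp.cost, RealExp.cost])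
      · rw [hU.eval_read_work hυ3 hυ3 hp hp, hpp]
        exact hW
      · rw [hU.eval_workExp hυ1 hυ2]
        refine (hU.setWork (i := i) hj _).congr_work fun i' j' _ _ => ?_
        change updateEntry _ i j ((RealExp.read (workExp 1 2)).eval υ -
          (RealExp.read (workExp 1 3)).eval υ * (RealExp.read (workExp 3 2)).eval υ /
            (RealExp.read (workExp 3 3)).eval υ) i' j' = _
        rw [hU.eval_read_work hυ3 hυ3 hp hp, hU.eval_read_work hυ1 hυ2 hi hj, hU.eval_read_work hυ1 hυ3 hi hp,
          hU.eval_read_work hυ3 hυ2 hp hj, hpp]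
        unfold updateEntry
        split_ifs with he
        · obtain ⟨rfl, rfl⟩ := he
          have e1 : partialSchur W p i' j' i' j' = W i' j' := if_neg (by omega)
          have e2 : partialSchur W p i' j' i' p = W i' p := if_neg (by omega)
          have e3 : partialSchur W p i' j' p j' = W p j' := if_neg (by omega)
          rw [e1, e2, e3, partialSchur, if_pos (by omega)]
        · simp only [partialSchur]
          congr 1
          rw [eq_iff_iff]
          omega
    · rintro υ ⟨hU, hυ3, hυ1⟩
      refine ⟨⟨hU.congr_work fun i' j' _ hj' => ?_, hυ3⟩, hυ1, hU.size⟩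
      simp only [partialSchur]
      congr 1
      rw [eq_iff_iff]
      omega

/-- Before round p the block starting at (p, p) is the p-th iterated Schur complement. Positivity of
the form makes its corner positive, so both the logarithm and the divisions are legal. -/
theorem runs_eliminate (x : ℕ → ℝ) (hN : 1 ≤ N) (hW : PosForm N W)
    (h : Holds N A t σ S K W l pos) :
    Runs x eliminate σ (N * (30 + N * (N * (70 + 16) + 16) + 16)) fun τ =>
      ∃ V, Holds N A t τ (S + Real.log (Matrix.of fun i j : Fin N => W i j).det) K V l pos := by
  refine Runs.mono (Runs.forLoop (Inv := fun p τ => ∃ V, Holds N A t τ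
    (S + ∑ q ∈ Finset.range p, Real.log ((schur^[q] W) 0 0)) K V l pos ∧
    ∀ i j, p + i < N → p + j < N → V (p + i) (p + j) = (schur^[p] W) i j)
    (by omega) (by simp [IdxExp.cost]) hN h.size (by simp [IdxExp.eval]) ?_ ?_ ?_) le_rfl ?_
  · rintro p v τ ⟨V, h1, h2⟩
    exact ⟨V, h1.setIdx v (by omega) (by omega), h2⟩
  · exact ⟨W, by simpa [IdxExp.eval] using h, by simp [IdxExp.eval]⟩
  · rintro p τ - hp ⟨V, hV, hVW⟩ hτ3 -
    have hpp : V p p = (schur^[p] W) 0 0 := hVW 0 0 hp hp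
    have hpos : 0 < V p p := by rw [hpp]; exact hW.iterate_pivot_pos hp
    refine Runs.seq (Runs.write ⟨trivial, trivial, ?_⟩ ?_ ?_)
    · rw [hV.eval_read_work hτ3 hτ3 hp hp]; exact hpos
    · refine (runs_eliminateBlock x hp hpos.ne' (hV.setCellOne _) hτ3).mono le_rfl ?_
      rintro υ ⟨hU, hυ3⟩
      refine ⟨⟨partialSchur V p N 0, ?_, ?_⟩, hυ3, hU.size⟩
      · convert! hU using 1
        change _ = τ.mem 1 + Real.log ((RealExp.read (workExp 3 3)).eval τ)
        rw [hV.cell_one, hV.eval_read_work hτ3 hτ3 hp hp, Finset.sum_range_succ, hpp, ← add_assoc]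
      · intro i j hi hj
        rw [partialSchur, if_pos (by omega), Function.iterate_succ_apply', schur, hpp,
          ← hVW (i + 1) (j + 1) (by omega) (by omega), ← hVW (i + 1) 0 (by omega) (by omega),
          ← hVW 0 (j + 1) (by omega) (by omega)]
        simp only [show ∀ k, p + 1 + k = p + (k + 1) by intro k; omega, add_zero]
    · simp [workExp, IdxExp.cost, RealExp.cost]
  · rintro τ ⟨V, hV, -⟩
    exact ⟨V, by rw [hW.log_det]; exact hV⟩

end Eliminate

/-! ### Finding the largest entry -/

/-- The address of the first entry of the work array. -/
def firstWorkExp : IdxExp := .add (.const 3) (.mul (.reg 0) (.reg 0))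

/-- The computation of the largest entry of the input matrix. -/
def findMax : Program :=
  forLoop 1 (.const 0) (forLoop 2 (.const 0)
    (.ite (.realLt (.read firstWorkExp) (.read (matrixExp 1 2)))
      (.write firstWorkExp (.read (matrixExp 1 2))) .skip))

section FindMax

variable {N : ℕ} {A : ℕ → ℕ → ℝ} {t : ℝ} {σ : State} {S K : ℝ} {W : ℕ → ℕ → ℝ} {l pos : ℕ}

theorem Holds.eval_firstWorkExp (h : Holds N A t σ S K W l pos) :
    firstWorkExp.eval σ = workAddr N 0 0 := by
  simp [firstWorkExp, IdxExp.eval, h.size, workAddr]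

theorem Holds.eval_read_firstWorkExp (h : Holds N A t σ S K W l pos) (hN : 1 ≤ N) :
    (RealExp.read firstWorkExp).eval σ = W 0 0 := by
  rw [RealExp.eval, h.eval_firstWorkExp, h.work 0 0 hN hN]

/-- The first work cell is a running maximum. Its initial content need only be at most a, which is
why an upper bound is carried in the invariant. -/
theorem runs_findMax (x : ℕ → ℝ) (hN : 1 ≤ N) (h : Holds N A t σ S K W l pos) {a : ℝ}
    (ha : W 0 0 ≤ a) (hA : ∀ i j, i < N → j < N → A i j ≤ a) :
    Runs x findMax σ (N * (N * (40 + 16) + 16)) fun τ =>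
      ∃ V, Holds N A t τ S K V l pos ∧ V 0 0 ≤ a ∧ ∀ i j, i < N → j < N → A i j ≤ V 0 0 := by
  refine Runs.mono (Runs.forLoop (Inv := fun i τ => ∃ V, Holds N A t τ S K V l pos ∧ V 0 0 ≤ a ∧
    ∀ i' j', i' < i → j' < N → A i' j' ≤ V 0 0)
    (by omega) (by simp [IdxExp.cost]) hN h.size (by simp [IdxExp.eval]) ?_ ?_ ?_) le_rfl
    fun τ h => h
  · rintro p v τ ⟨V, h1, h2⟩
    exact ⟨V, h1.setIdx v (by omega) (by omega), h2⟩
  · exact ⟨W, h, ha, by simp [IdxExp.eval]⟩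
  · rintro i τ - hi ⟨V, hV, hVa, hVA⟩ hτ1 hτN
    refine Runs.mono (Runs.forLoop (Inv := fun j τ => (∃ V, Holds N A t τ S K V l pos ∧ V 0 0 ≤ a ∧
      ∀ i' j', (i' < i ∨ i' = i ∧ j' < j) → j' < N → A i' j' ≤ V 0 0) ∧ τ.idx 1 = i)
      (by omega) (by simp [IdxExp.cost]) hN hτN (by simp [IdxExp.eval]) ?_ ?_ ?_) le_rfl ?_
    · rintro p v τ ⟨⟨V, h1, h2⟩, h3⟩
      exact ⟨⟨V, h1.setIdx v (by omega) (by omega), h2⟩, by simpa [State.setIdx] using h3⟩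
    · exact ⟨⟨V, hV, hVa, fun i' j' hi' hj' =>
        hVA i' j' (by simpa [IdxExp.eval] using hi') hj'⟩, hτ1⟩
    · rintro j υ - hj ⟨⟨U, hU, hUa, hUA⟩, hυ1⟩ hυ2 hυN
      refine Runs.mono (Runs.ite (c := 20) ⟨trivial, trivial⟩ ?_ ?_)
        (by simp [Test.cost, RealExp.cost, firstWorkExp, matrixExp, IdxExp.cost]) fun τ h => h
      · intro hlt
        simp only [Test.Holds, hU.eval_read_firstWorkExp hN,
          hU.eval_read_matrix hυ1 hυ2 hi hj] at hlt
        refine Runs.write trivial ⟨⟨⟨updateEntry U 0 0 (A i j), ?_, ?_, ?_⟩, hυ1⟩, hυ2, hυN⟩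
          (by simp [RealExp.cost, firstWorkExp, matrixExp, IdxExp.cost])
        · rw [hU.eval_firstWorkExp, hU.eval_read_matrix hυ1 hυ2 hi hj]
          exact hU.setWork hN _
        · simpa [updateEntry] using hA i j hi hj
        · intro i' j' hij hj'
          simp only [updateEntry, and_self, if_true]
          by_cases he : i' = i ∧ j' = j
          · rw [he.1, he.2]
          · exact (hUA i' j' (by omega) hj').trans hlt.le
      · intro hlt
        simp only [Test.Holds, hU.eval_read_firstWorkExp hN,
          hU.eval_read_matrix hυ1 hυ2 hi hj, not_lt] at hlt
        refine Runs.skip ⟨⟨⟨U, hU, hUa, ?_⟩, hυ1⟩, hυ2, hυN⟩ (by omega)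
        intro i' j' hij hj'
        by_cases he : i' = i ∧ j' = j
        · rw [he.1, he.2]
          exact hlt
        · exact hUA i' j' (by omega) hj'
    · rintro υ ⟨⟨U, hU, hUa, hUA⟩, hυ1⟩
      exact ⟨⟨U, hU, hUa, fun i' j' hi' hj' => hUA i' j' (by omega) hj'⟩, hυ1, hU.size⟩

end FindMax

/-! ### Sample positions, the whole program and its correctness -/

/-- The position of the sample used for the pair `q` among the `N²` samples for one matrix. -/
def entryCode {N : ℕ} : Sym2 (Fin N) → ℕ :=
  Sym2.lift ⟨fun i j => min (i : ℕ) j * N + max (i : ℕ) j, fun i j => by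
    simp only [min_comm (i : ℕ), max_comm (i : ℕ)]⟩

theorem entryCode_mk {N : ℕ} (i j : Fin N) :
    entryCode s(i, j) = min (i : ℕ) j * N + max (i : ℕ) j := rfl

theorem entryCode_lt {N : ℕ} (q : Sym2 (Fin N)) : entryCode q < N * N := by
  induction q with | _ i j =>
  rw [entryCode_mk]
  exact index_lt (by omega) (by omega)

theorem entryCode_injective {N : ℕ} : Function.Injective (entryCode (N := N)) := by
  intro q q' h
  induction q with | _ i j =>
  induction q' with | _ i' j' =>
  rw [entryCode_mk, entryCode_mk] at h
  have := index_inj (by omega) (by omega) h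
  rw [Sym2.eq_iff]
  simp only [Fin.ext_iff]
  omega

/-- The position of the sample used for the pair `q` of the `l`-th matrix. -/
def sampleIndex (N k : ℕ) : Fin k × Sym2 (Fin N) ↪ ℕ where
  toFun p := p.1 * (N * N) + entryCode p.2
  inj' := by
    rintro ⟨l, q⟩ ⟨l', q'⟩ h
    have := index_inj (entryCode_lt q) (entryCode_lt q') h
    exact Prod.ext (Fin.ext this.1) (entryCode_injective this.2)

theorem sampledArray_eq {N : ℕ} {A : Matrix (Fin N) (Fin N) ℝ} (hA : Aᵀ = -A) (t : ℝ) (x : ℕ → ℝ)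
    (pos : ℕ) (i j : Fin N) :
    sampledArray N (toArray A) t x pos i j =
      (Real.sqrt t • (1 : Matrix (Fin N) (Fin N) ℝ) + Y A fun q => x (pos + entryCode q)) i j := by
  simp only [sampledArray, toArray_val, Matrix.add_apply, Matrix.smul_apply, Y, Matrix.of_apply,
    entryCode_mk]
  rcases lt_trichotomy i j with h | h | h
  · have h' : (i : ℕ) < j := h
    rw [if_neg (by omega), if_pos h', Matrix.one_apply_ne h.ne, min_eq_left h'.le,
      max_eq_right h'.le]
    simp
  · subst h
    have hd : A i i = 0 := by have := skew_apply hA i i; linarith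
    simp [hd]
  · have h' : (j : ℕ) < i := h
    rw [if_pos h', Matrix.one_apply_ne h.ne', min_eq_right h'.le, max_eq_left h'.le,
      skew_apply hA j i]
    simp

/-- The number `8 a² N log (4/δ) / (t ε²)`, where `a`, `t`, `ε` and `δ` are in the first work cell
and in cells `0`, `1` and `2`. -/
def countExp : RealExp :=
  .div (.mul (.mul (.mul (.ofIdx (.const 8)) (.mul (.read firstWorkExp) (.read firstWorkExp)))
      (.ofIdx (.reg 0))) (.log (.div (.ofIdx (.const 4)) (.read (.const 2)))))
    (.mul (.read (.const 0)) (.mul (.read (.const 1)) (.read (.const 1))))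

/-- The main loop: while the number of determinants is too small, compute another one. -/
def mainLoop : Program :=
  .loop (.realLt (.ofIdx (.reg 4)) (.read (.const 2)))
    (.seq fillMatrix (.seq eliminate (.setIdx 4 (.add (.reg 4) (.const 1)))))

/-- The program which computes the geometric mean of sampled determinants. -/
def approxProgram : Program :=
  .seq findMax (.seq (.write (.const 2) countExp) (.seq (.write (.const 1) (.ofIdx (.const 0)))
    (.seq mainLoop
      (.write (.const 0) (.exp (.div (.read (.const 1)) (.ofIdx (.reg 4))))))))

theorem maxAbs_le {N : ℕ} [NeZero N] {A : Matrix (Fin N) (Fin N) ℝ} {b : ℝ}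
    (h : ∀ i j, |A i j| ≤ b) : maxAbs A ≤ b :=
  ciSup_le fun p => h p.1 p.2

theorem holds_input (I : Instance) (ε δ : ℝ) :
    Holds I.N (toArray I.A) I.t (I.input ε δ) ε δ
      (fun i j => (I.input ε δ).mem (workAddr I.N i j)) 0 0 where
  size := by simp [Instance.input]
  count := by simp [Instance.input]
  pos_eq := rfl
  cell_zero := by simp [Instance.input]
  cell_one := by simp [Instance.input]
  cell_two := by simp [Instance.input]
  matrix i j hi hj := by
    have h := index_lt hi hj
    have e : finProdFinEquiv.symm ⟨i * I.N + j, h⟩ = ((⟨i, hi⟩ : Fin I.N), (⟨j, hj⟩ : Fin I.N)) := by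
      rw [Equiv.symm_apply_eq, Fin.ext_iff]
      simp only [finProdFinEquiv_apply_val]
      ring
    simp only [Instance.input, Nat.add_sub_cancel_left]
    rw [if_neg (by omega), if_neg (by omega), if_neg (by omega), dif_pos h, e, toArray,
      dif_pos ⟨hi, hj⟩]
  work _ _ _ _ := rfl

section MainLoop

variable {N : ℕ} {A : Matrix (Fin N) (Fin N) ℝ} {t : ℝ} {σ : State} {K : ℝ} {W : ℕ → ℕ → ℝ}

/-- Comparing the integer counter with the real number K runs the body exactly ⌈K⌉ times, so no
rounding instruction is needed. -/
theorem runs_mainLoop (x : ℕ → ℝ) (hA : Aᵀ = -A) (ht : 0 < t) (hN : 1 ≤ N)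
    (h : Holds N (toArray A) t σ 0 K W 0 0) :
    Runs x mainLoop σ (⌈K⌉₊ * (5 + (N * (N * (100 + 16) + 16) +
        (N * (30 + N * (N * (70 + 16) + 16) + 16) + 4))) + 5) fun τ =>
      ∃ V, Holds N (toArray A) t τ (∑ m ∈ Finset.range ⌈K⌉₊,
        Real.log (detY A t fun q => x (m * (N * N) + entryCode q))) K V ⌈K⌉₊ (⌈K⌉₊ * (N * N)) := by
  refine Runs.mono (Runs.loop (a := 0) (Inv := fun l τ => ∃ V, Holds N (toArray A) t τ
    (∑ m ∈ Finset.range l, Real.log (detY A t fun q => x (m * (N * N) + entryCode q))) K V l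
    (l * (N * N))) (n := ⌈K⌉₊) (c := N * (N * (100 + 16) + 16) +
        (N * (30 + N * (N * (70 + 16) + 16) + 16) + 4)) (fun _ _ _ => ⟨trivial, trivial⟩)
    ?_ ?_ (Nat.zero_le _) ?_) (by simp [Test.cost, RealExp.cost, IdxExp.cost]) fun τ h => h
  · rintro l τ - ⟨V, hV⟩
    change ((τ.idx 4 : ℕ) : ℝ) < τ.mem 2 ↔ _
    rw [hV.count, hV.cell_two, Nat.lt_ceil]
  · rintro l τ - hl ⟨V, hV⟩
    refine Runs.seq ((runs_fillMatrix x ht.le hN hV).mono le_rfl fun υ hυ => ?_)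
    have hpf := posForm_of_skew (Y_transpose hA fun q => x (l * (N * N) + entryCode q))
      (Real.sqrt_pos.2 ht) (M := sampledArray N (toArray A) t x (l * (N * N)))
      fun i j => sampledArray_eq hA t x _ i j
    refine Runs.seq ((runs_eliminate x hN hpf hυ).mono le_rfl ?_)
    rintro ω ⟨U, hU⟩
    refine Runs.setIdx ⟨U, ?_⟩ (by simp [IdxExp.cost])
    have e : (IdxExp.add (.reg 4) (.const 1)).eval ω = l + 1 := by simp [IdxExp.eval, hU.count]
    have hd : (Matrix.of fun i j : Fin N => sampledArray N (toArray A) t x (l * (N * N)) i j).det =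
        detY A t fun q => x (l * (N * N) + entryCode q) := by
      simp only [sampledArray_eq hA]
      rfl
    rw [e, Finset.sum_range_succ, ← hd, Nat.succ_mul]
    exact hU.setCount _
  · exact ⟨W, by simpa using h⟩

end MainLoop

theorem Instance.one_le_N (I : Instance) : 1 ≤ I.N := by
  by_contra h
  have hN : I.N = 0 := by omega
  apply I.ne_zero
  ext i
  exact absurd i.2 (by omega)

theorem geomMeanDet_eq_exp {N : ℕ} {A : Matrix (Fin N) (Fin N) ℝ} (hA : Aᵀ = -A) {t : ℝ}
    (ht : 0 < t) {k : ℕ} (ξ : Fin k → Sym2 (Fin N) → ℝ) :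
    geomMeanDet A t ξ = Real.exp ((1 / (k : ℝ)) * ∑ l, Real.log (detY A t (ξ l))) := by
  rw [geomMeanDet, Real.rpow_def_of_pos (Finset.prod_pos fun l _ => detY_pos hA ht _),
    Real.log_prod fun l _ => (detY_pos hA ht _).ne', mul_comm]

theorem Instance.count_pos (I : Instance) {ε δ : ℝ} (hε : 0 < ε) (hδ : 0 < δ) (hδ' : δ < 1) :
    0 < 8 * maxAbs I.A ^ 2 * I.N * Real.log (4 / δ) / (I.t * ε ^ 2) := by
  have h1 := maxAbs_pos I.ne_zero
  have h2 : (0 : ℝ) < I.N := by exact_mod_cast I.one_le_N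
  have h3 : 0 < Real.log (4 / δ) := Real.log_pos (by rw [lt_div_iff₀ hδ]; linarith)
  have := I.t_pos
  positivity

theorem Instance.one_le_sampleCount (I : Instance) {ε δ : ℝ} (hε : 0 < ε) (hδ : 0 < δ)
    (hδ' : δ < 1) : 1 ≤ I.sampleCount ε δ :=
  Nat.ceil_pos.2 (I.count_pos hε hδ hδ')

theorem runs_approxProgram (I : Instance) {ε δ : ℝ} (hε : 0 < ε) (hδ : 0 < δ) (hδ' : δ < 1)
    (x : ℕ → ℝ) :
    Runs x approxProgram (I.input ε δ) (1000 * I.N ^ 3 * (1 + I.sampleCount ε δ)) fun τ =>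
      τ.mem 0 = geomMeanDet I.A I.t fun l q => x (sampleIndex I.N (I.sampleCount ε δ) (l, q)) := by
  have hN := I.one_le_N
  have : NeZero I.N := ⟨by omega⟩
  set k := I.sampleCount ε δ with hk
  have hk1 : 1 ≤ k := I.one_le_sampleCount hε hδ hδ'
  have hcost : I.N * (I.N * (40 + 16) + 16) + (50 + (10 + ((k * (5 + (I.N * (I.N * (100 + 16) + 16) +
      (I.N * (30 + I.N * (I.N * (70 + 16) + 16) + 16) + 4))) + 5) + 10))) ≤
      1000 * I.N ^ 3 * (1 + k) := by
    have e1 : I.N ≤ I.N ^ 3 := Nat.le_self_pow (by omega) _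
    have e2 : I.N ^ 2 ≤ I.N ^ 3 := Nat.pow_le_pow_right hN (by omega)
    have e3 : k * I.N ≤ k * I.N ^ 3 := Nat.mul_le_mul_left _ e1
    have e4 : k * I.N ^ 2 ≤ k * I.N ^ 3 := Nat.mul_le_mul_left _ e2
    have e5 : k * 1 ≤ k * I.N ^ 3 := Nat.mul_le_mul_left _ (hN.trans e1)
    nlinarith
  refine Runs.mono ?_ hcost fun τ h => h
  have h0 := holds_input I ε δ
  -- The work array begins just past the input matrix, where the initial memory is zero; zero is a
  -- legitimate starting value for the maximum.
  have hW0 : (I.input ε δ).mem (workAddr I.N 0 0) = 0 := by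
    simp only [Instance.input, workAddr]
    rw [if_neg (by omega), if_neg (by omega), if_neg (by omega), dif_neg (by omega)]
  have hAle : ∀ i j, i < I.N → j < I.N → toArray I.A i j ≤ maxAbs I.A := by
    intro i j hi hj
    rw [toArray, dif_pos ⟨hi, hj⟩]
    exact (le_abs_self _).trans (abs_le_maxAbs _ _ _)
  refine Runs.seq ((runs_findMax x hN h0 (a := maxAbs I.A) ?_ hAle).mono le_rfl ?_)
  · simp only [hW0]
    exact (maxAbs_pos I.ne_zero).le
  rintro σ₁ ⟨V, hV, hVa, hVA⟩
  -- The maximum was taken without absolute values; skew symmetry supplies -a_ij as the entry a_ji.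
  have hmax : V 0 0 = maxAbs I.A := by
    refine le_antisymm hVa (maxAbs_le fun i j => abs_le'.2 ⟨?_, ?_⟩)
    · simpa using hVA i j i.2 j.2
    · rw [← skew_apply I.skew]
      simpa using hVA j i j.2 i.2
  have hlogarg : (RealExp.div (.ofIdx (.const 4)) (.read (.const 2))).eval σ₁ = 4 / δ := by
    change ((4 : ℕ) : ℝ) / σ₁.mem 2 = _
    rw [hV.cell_two]
    norm_num
  have hden : (RealExp.mul (.read (.const 0)) (.mul (.read (.const 1)) (.read (.const 1)))).eval σ₁ =
      I.t * ε ^ 2 := by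
    change σ₁.mem 0 * (σ₁.mem 1 * σ₁.mem 1) = _
    rw [hV.cell_zero, hV.cell_one, pow_two]
  have hK : countExp.eval σ₁ = 8 * maxAbs I.A ^ 2 * I.N * Real.log (4 / δ) / (I.t * ε ^ 2) := by
    change ((8 : ℕ) : ℝ) * ((RealExp.read firstWorkExp).eval σ₁ *
      (RealExp.read firstWorkExp).eval σ₁) * ((σ₁.idx 0 : ℕ) : ℝ) *
      Real.log ((RealExp.div (.ofIdx (.const 4)) (.read (.const 2))).eval σ₁) /
      (RealExp.mul (.read (.const 0)) (.mul (.read (.const 1)) (.read (.const 1)))).eval σ₁ = _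
    rw [hlogarg, hden, hV.eval_read_firstWorkExp hN, hmax, hV.size, pow_two (maxAbs I.A)]
    norm_num
  refine Runs.seq (Runs.write ⟨⟨⟨⟨trivial, trivial, trivial⟩, trivial⟩, ⟨trivial, trivial, ?_⟩, ?_⟩,
    ⟨trivial, trivial, trivial⟩, ?_⟩ ?_ (by simp [countExp, firstWorkExp, RealExp.cost, IdxExp.cost]))
  · change σ₁.mem 2 ≠ 0
    rw [hV.cell_two]
    exact hδ.ne'
  · rw [hlogarg]
    positivity
  · rw [hden]
    have := I.t_pos
    positivity
  -- The cells of δ and ε are no longer needed; they are reused for K and for the sum of the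
  -- logarithms.
  have h2 := hV.setCellTwo (countExp.eval σ₁)
  set K := countExp.eval σ₁
  have hkK : ⌈K⌉₊ = k := by rw [hK]; rfl
  refine Runs.seq (Runs.write trivial ?_ (by simp [RealExp.cost, IdxExp.cost]))
  have h3 := h2.setCellOne ((RealExp.ofIdx (.const 0)).eval (σ₁.setMem 2 K))
  have hz : (RealExp.ofIdx (.const 0)).eval (σ₁.setMem 2 K) = 0 := by
    simp [RealExp.eval, IdxExp.eval]
  rw [hz] at h3
  have hmain := runs_mainLoop x I.skew I.t_pos hN h3
  rw [hkK] at hmain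
  refine Runs.seq (Runs.mono (hz.symm ▸ hmain) le_rfl ?_)
  rintro τ ⟨U, hU⟩
  refine Runs.write ⟨trivial, trivial, ?_⟩ ?_ (by simp [RealExp.cost, IdxExp.cost])
  · change ((τ.idx 4 : ℕ) : ℝ) ≠ 0
    rw [hU.count]
    exact_mod_cast (by omega : k ≠ 0)
  · have e : ∀ v, (τ.setMem ((IdxExp.const 0).eval τ) v).mem 0 = v := fun v => by
      simp [State.setMem, IdxExp.eval]
    rw [e]
    change Real.exp (τ.mem 1 / ((τ.idx 4 : ℕ) : ℝ)) = _
    rw [hU.count, hU.cell_one, geomMeanDet_eq_exp I.skew I.t_pos, one_div, inv_mul_eq_div,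
      ← Fin.sum_univ_eq_sum_range
        (fun m => Real.log (detY I.A I.t fun q => x (m * (I.N * I.N) + entryCode q)))]
    rfl


/-! ### Failure probability and running time -/

/-- After a shift by u, the density at y + u is at most e^(-u²/2) times the density at y when y > 0.
Comparing with a half-line rather than the whole line saves the factor two in the two-sided tail. -/
theorem gaussianReal_Ioi_le {u : ℝ} (hu : 0 ≤ u) :
    gaussianReal 0 1 (Set.Ioi u) ≤
      ENNReal.ofReal (Real.exp (-u ^ 2 / 2)) * gaussianReal 0 1 (Set.Ioi 0) := by
  rw [gaussianReal_apply _ one_ne_zero, gaussianReal_apply _ one_ne_zero,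
    ← lintegral_indicator measurableSet_Ioi, ← lintegral_indicator measurableSet_Ioi,
    ← lintegral_add_right_eq_self _ u, ← lintegral_const_mul' _ _ ENNReal.ofReal_ne_top]
  refine lintegral_mono fun y => ?_
  by_cases hy : 0 < y
  · rw [Set.indicator_of_mem (show y + u ∈ Set.Ioi u by simpa using hy),
      Set.indicator_of_mem (show y ∈ Set.Ioi 0 from hy), gaussianPDF, gaussianPDF,
      ← ENNReal.ofReal_mul (Real.exp_pos _).le]
    refine ENNReal.ofReal_le_ofReal ?_
    simp only [gaussianPDFReal, NNReal.coe_one, mul_one, sub_zero]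
    rw [mul_left_comm, ← Real.exp_add]
    refine mul_le_mul_of_nonneg_left (Real.exp_le_exp.2 ?_) (by positivity)
    nlinarith [mul_nonneg hy.le hu]
  · rw [Set.indicator_of_notMem (by simpa using hy)]
    exact zero_le

theorem gaussianReal_Iio_neg (u : ℝ) :
    gaussianReal 0 1 (Set.Iio (-u)) = gaussianReal 0 1 (Set.Ioi u) := by
  have h := gaussianReal_map_neg (μ := 0) (v := 1)
  rw [neg_zero] at h
  conv_lhs => rw [← h]
  rw [Measure.map_apply measurable_neg measurableSet_Iio]
  congr 1
  ext x
  simp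

/-- The tail bound for a standard Gaussian, without a factor two. -/
theorem gaussianReal_real_lt_abs_le {u : ℝ} (hu : 0 ≤ u) :
    (gaussianReal 0 1).real {x | u < |x|} ≤ Real.exp (-u ^ 2 / 2) := by
  have hsplit : ∀ v : ℝ, 0 ≤ v → gaussianReal 0 1 {x | v < |x|} = 2 * gaussianReal 0 1 (Set.Ioi v) := by
    intro v hv
    have : {x : ℝ | v < |x|} = Set.Ioi v ∪ Set.Iio (-v) := by
      ext x
      simp [lt_abs, lt_neg]
    rw [this, measure_union _ measurableSet_Iio, gaussianReal_Iio_neg, two_mul]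
    rw [Set.disjoint_left]
    intro x hx hx'
    simp only [Set.mem_Ioi, Set.mem_Iio] at hx hx'
    linarith
  refine ENNReal.toReal_le_of_le_ofReal (Real.exp_pos _).le ?_
  rw [hsplit u hu]
  calc 2 * gaussianReal 0 1 (Set.Ioi u) ≤
        ENNReal.ofReal (Real.exp (-u ^ 2 / 2)) * (2 * gaussianReal 0 1 (Set.Ioi 0)) := by
        rw [mul_left_comm]
        gcongr
        exact gaussianReal_Ioi_le hu
    _ ≤ ENNReal.ofReal (Real.exp (-u ^ 2 / 2)) * 1 := by
        gcongr
        rw [← hsplit 0 le_rfl]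
        exact prob_le_one
    _ = _ := mul_one _

section Approximation

variable (I : Instance) {ε δ : ℝ}

theorem measure_log_error_le (hε : 0 < ε) (hδ : 0 < δ) (hδ' : δ < 1) :
    RealRAM.gaussianSamples.real {x | ε / 2 ≤ |(1 / (I.sampleCount ε δ : ℝ)) *
      ∑ l, Real.log (detY I.A I.t fun q => x (sampleIndex I.N (I.sampleCount ε δ) (l, q))) -
        logPhiTilde I.A I.t|} ≤ δ / 2 := by
  have hN : (0 : ℝ) < I.N := by exact_mod_cast I.one_le_N
  have ha := maxAbs_pos I.ne_zero
  have ht := I.t_pos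
  have h := mean_log_detY_concentration I.skew I.ne_zero I.t_pos
    (I.one_le_sampleCount hε hδ hδ')
    (hasLaw_comp_gaussianSamples (sampleIndex I.N (I.sampleCount ε δ)).injective)
    -- The deviation is then ε/2 and the exponent tkε²/(8a²N), at least log(4/δ) by the choice of k;
    -- the bound becomes 2 · δ/4.
    (r := ε / (2 * I.N)) (by positivity)
  rw [show (I.N : ℝ) * (ε / (2 * I.N)) = ε / 2 by field_simp] at h
  refine h.trans ?_
  have hk : 8 * maxAbs I.A ^ 2 * I.N * Real.log (4 / δ) / (I.t * ε ^ 2) ≤ I.sampleCount ε δ :=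
    Nat.le_ceil _
  rw [div_le_iff₀ (by positivity)] at hk
  have hexp : -(I.t * (I.sampleCount ε δ) * I.N * (ε / (2 * I.N)) ^ 2) / (2 * maxAbs I.A ^ 2) ≤
      -Real.log (4 / δ) := by
    rw [neg_div, neg_le_neg_iff, le_div_iff₀ (by positivity)]
    have e : I.t * (I.sampleCount ε δ) * I.N * (ε / (2 * I.N)) ^ 2 =
        I.sampleCount ε δ * (I.t * ε ^ 2) / (4 * I.N) := by
      field_simp
      ring
    rw [e, le_div_iff₀ (by positivity)]
    linarith
  refine (mul_le_mul_of_nonneg_left (Real.exp_le_exp.2 hexp) (by norm_num)).trans_eq ?_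
  rw [Real.exp_neg, Real.exp_log (by positivity)]
  field_simp
  norm_num

/-- Diagonal variables can be ignored, since A has zero diagonal. The remaining kN(N-1)/2 variables
each exceed the threshold with probability at most δ/(N²k), so the union bound stays below δ/2. -/
theorem measure_large_sample_le (hε : 0 < ε) (hδ : 0 < δ) (hδ' : δ < 1) :
    RealRAM.gaussianSamples.real {x | ∃ (l : Fin (I.sampleCount ε δ)) (q : Sym2 (Fin I.N)),
      ¬ q.IsDiag ∧ Real.sqrt (2 * Real.log ((I.N : ℝ) ^ 2 * I.sampleCount ε δ / δ)) <
        |x (sampleIndex I.N (I.sampleCount ε δ) (l, q))|} ≤ δ / 2 := by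
  classical
  set k := I.sampleCount ε δ with hkdef
  set u := Real.sqrt (2 * Real.log ((I.N : ℝ) ^ 2 * k / δ)) with hu
  have hN : (1 : ℝ) ≤ I.N := by exact_mod_cast I.one_le_N
  have hk : (1 : ℝ) ≤ k := by exact_mod_cast I.one_le_sampleCount hε hδ hδ'
  have hR : 1 ≤ (I.N : ℝ) ^ 2 * k / δ := by
    rw [le_div_iff₀ hδ]
    nlinarith [mul_le_mul (one_le_pow₀ hN (n := 2)) hk (by norm_num) (by positivity)]
  have hu2 : Real.exp (-u ^ 2 / 2) = δ / ((I.N : ℝ) ^ 2 * k) := by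
    rw [hu, Real.sq_sqrt (mul_nonneg (by norm_num) (Real.log_nonneg hR)), neg_div,
      mul_div_cancel_left₀ _ (two_ne_zero), Real.exp_neg, Real.exp_log (by linarith), inv_div]
  have hone : ∀ n, RealRAM.gaussianSamples.real {x | u < |x n|} ≤ δ / ((I.N : ℝ) ^ 2 * k) := by
    intro n
    have hl : HasLaw (fun x : ℕ → ℝ => x n) (gaussianReal 0 1) RealRAM.gaussianSamples :=
      ⟨(measurable_pi_apply _).aemeasurable,
        (measurePreserving_eval_infinitePi (fun _ : ℕ => gaussianReal 0 1) n).map_eq⟩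
    rw [← hu2]
    refine le_trans (le_of_eq ?_) (gaussianReal_real_lt_abs_le (Real.sqrt_nonneg _))
    exact HasLaw.real_preimage hl (s := {y : ℝ | u < |y|})
      (measurableSet_lt measurable_const measurable_id.abs)
  set T : Finset (Fin k × Sym2 (Fin I.N)) :=
    Finset.univ ×ˢ Finset.univ.filter fun q => ¬ q.IsDiag with hT
  have hcard : (T.card : ℝ) = k * (I.N * (I.N - 1) / 2) := by
    rw [hT, Finset.card_product, Finset.card_univ, Fintype.card_fin, ← Fintype.card_subtype,
      Sym2.card_subtype_not_diag, Fintype.card_fin]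
    push_cast
    rw [Nat.cast_choose_two]
  have hsub : {x : ℕ → ℝ | ∃ (l : Fin k) (q : Sym2 (Fin I.N)), ¬ q.IsDiag ∧
      u < |x (sampleIndex I.N k (l, q))|} ⊆ ⋃ p ∈ T, {x | u < |x (sampleIndex I.N k p)|} := by
    rintro x ⟨l, q, hq, hx⟩
    simp only [Set.mem_iUnion]
    exact ⟨(l, q), by simp [hT, hq], hx⟩
  refine (measureReal_mono hsub (measure_ne_top _ _)).trans ((measureReal_biUnion_finset_le _ _).trans
    ((Finset.sum_le_sum fun p _ => hone _).trans ?_))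
  rw [Finset.sum_const, nsmul_eq_mul, hcard, mul_div_assoc', div_le_div_iff₀ (by positivity) two_pos]
  have : (k : ℝ) * (I.N * (I.N - 1) / 2) ≤ k * (I.N ^ 2 / 2) := by
    gcongr
    nlinarith
  nlinarith [mul_le_mul_of_nonneg_right this hδ.le]

theorem approximation_probability (hε : 0 < ε) (hε' : ε < 1) (hδ : 0 < δ) (hδ' : δ < 1) :
    1 - δ ≤ RealRAM.gaussianSamples.real {x |
      1 - ε < geomMeanDet I.A I.t (fun l q => x (sampleIndex I.N (I.sampleCount ε δ) (l, q))) /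
        PhiTilde I.A I.t ∧
      geomMeanDet I.A I.t (fun l q => x (sampleIndex I.N (I.sampleCount ε δ) (l, q))) /
        PhiTilde I.A I.t < 1 + ε ∧
      ∀ l i j, |Y I.A (fun q => x (sampleIndex I.N (I.sampleCount ε δ) (l, q))) i j| ≤
        maxAbs I.A * Real.sqrt (2 * Real.log ((I.N : ℝ) ^ 2 * I.sampleCount ε δ / δ))} := by
  have h1 := measure_log_error_le I hε hδ hδ'
  have h2 := measure_large_sample_le I hε hδ hδ'
  set G := {x : ℕ → ℝ |
      1 - ε < geomMeanDet I.A I.t (fun l q => x (sampleIndex I.N (I.sampleCount ε δ) (l, q))) /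
        PhiTilde I.A I.t ∧
      geomMeanDet I.A I.t (fun l q => x (sampleIndex I.N (I.sampleCount ε δ) (l, q))) /
        PhiTilde I.A I.t < 1 + ε ∧
      ∀ l i j, |Y I.A (fun q => x (sampleIndex I.N (I.sampleCount ε δ) (l, q))) i j| ≤
        maxAbs I.A * Real.sqrt (2 * Real.log ((I.N : ℝ) ^ 2 * I.sampleCount ε δ / δ))} with hG
  set B₁ := {x : ℕ → ℝ | ε / 2 ≤ |(1 / (I.sampleCount ε δ : ℝ)) *
      ∑ l, Real.log (detY I.A I.t fun q => x (sampleIndex I.N (I.sampleCount ε δ) (l, q))) -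
        logPhiTilde I.A I.t|} with hB₁
  set B₂ := {x : ℕ → ℝ | ∃ (l : Fin (I.sampleCount ε δ)) (q : Sym2 (Fin I.N)),
      ¬ q.IsDiag ∧ Real.sqrt (2 * Real.log ((I.N : ℝ) ^ 2 * I.sampleCount ε δ / δ)) <
        |x (sampleIndex I.N (I.sampleCount ε δ) (l, q))|} with hB₂
  have hcover : Set.univ ⊆ G ∪ (B₁ ∪ B₂) := by
    intro x _
    by_cases hx1 : x ∈ B₁
    · exact Or.inr (Or.inl hx1)
    by_cases hx2 : x ∈ B₂
    · exact Or.inr (Or.inr hx2)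
    left
    have hx1' := not_le.1 (Set.mem_ofPred_eq ▸ hx1 : ¬ (ε / 2 ≤ |_|))
    have hx2' : ∀ (l : Fin (I.sampleCount ε δ)) (q : Sym2 (Fin I.N)), ¬ q.IsDiag →
        |x (sampleIndex I.N (I.sampleCount ε δ) (l, q))| ≤
          Real.sqrt (2 * Real.log ((I.N : ℝ) ^ 2 * I.sampleCount ε δ / δ)) := by
      intro l q hq
      by_contra hc
      exact hx2 ⟨l, q, hq, not_le.1 hc⟩
    rw [abs_lt] at hx1'
    have hratio : geomMeanDet I.A I.t
        (fun l q => x (sampleIndex I.N (I.sampleCount ε δ) (l, q))) / PhiTilde I.A I.t =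
        Real.exp ((1 / (I.sampleCount ε δ : ℝ)) * ∑ l, Real.log (detY I.A I.t fun q =>
          x (sampleIndex I.N (I.sampleCount ε δ) (l, q))) - logPhiTilde I.A I.t) := by
      rw [geomMeanDet_eq_exp I.skew I.t_pos, PhiTilde, ← Real.exp_sub]
    refine ⟨?_, ?_, ?_⟩
    · rw [hratio]
      refine lt_of_lt_of_le ?_ (Real.add_one_le_exp _)
      linarith [hx1'.1]
    · rw [hratio]
      refine (Real.exp_lt_exp.2 hx1'.2).trans_le ?_
      -- e^v ≤ 1 + v + v² at v = ε/2, and ε/2 + ε²/4 ≤ ε because ε < 1.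
      have := (abs_le.1 (Real.abs_exp_sub_one_sub_id_le (x := ε / 2)
        (by rw [abs_of_pos (by positivity)]; linarith))).2
      nlinarith
    · intro l i j
      rw [Y, Matrix.of_apply, abs_mul]
      by_cases hij : i = j
      · subst hij
        have hd : I.A i i = 0 := by have := skew_apply I.skew i i; linarith
        rw [hd, abs_zero, zero_mul]
        exact mul_nonneg (maxAbs_pos I.ne_zero).le (Real.sqrt_nonneg _)
      · exact mul_le_mul (abs_le_maxAbs _ _ _) (hx2' l s(i, j) (by simpa using hij))
          (abs_nonneg _) (maxAbs_pos I.ne_zero).le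
  have h3 := (measureReal_mono (μ := RealRAM.gaussianSamples) hcover).trans
    ((measureReal_union_le _ _).trans (add_le_add_right (measureReal_union_le _ _) _))
  rw [probReal_univ] at h3
  linarith

theorem cost_le (hε : 0 < ε) (hδ : 0 < δ) (hδ' : δ < 1) {s : ℕ}
    (hs : s ≤ 1000 * I.N ^ 3 * (1 + I.sampleCount ε δ)) :
    (s : ℝ) ≤ 8000 * (I.N : ℝ) ^ 3 *
      (1 + maxAbs I.A ^ 2 * I.N * Real.log (4 / δ) / (I.t * ε ^ 2)) := by
  have h1 : (s : ℝ) ≤ 1000 * (I.N : ℝ) ^ 3 * (1 + I.sampleCount ε δ) := by exact_mod_cast hs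
  have h2 := Nat.ceil_lt_add_one (I.count_pos hε hδ hδ').le
  change (I.sampleCount ε δ : ℝ) < _ at h2
  have e : 8 * maxAbs I.A ^ 2 * I.N * Real.log (4 / δ) / (I.t * ε ^ 2) =
      8 * (maxAbs I.A ^ 2 * I.N * Real.log (4 / δ) / (I.t * ε ^ 2)) := by ring
  rw [e] at h2
  refine h1.trans ?_
  -- The ceiling adds at most one, so 1 + k ≤ 2 + 8Q ≤ 8(1 + Q) with Q = a²N log(4/δ)/(tε²).
  rw [show (8000 : ℝ) * (I.N : ℝ) ^ 3 * (1 + maxAbs I.A ^ 2 * I.N * Real.log (4 / δ) /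
    (I.t * ε ^ 2)) = 1000 * (I.N : ℝ) ^ 3 * (8 + 8 * (maxAbs I.A ^ 2 * I.N * Real.log (4 / δ) /
    (I.t * ε ^ 2))) by ring]
  refine mul_le_mul_of_nonneg_left ?_ (by positivity)
  linarith

theorem cost_le_poly (hε : 0 < ε) (hδ : 0 < δ) (hδ' : δ < 1) :
    8000 * (I.N : ℝ) ^ 3 * (1 + maxAbs I.A ^ 2 * I.N * Real.log (4 / δ) / (I.t * ε ^ 2)) ≤
      32000 * (1 + I.size + 1 / ε + Real.log (1 / δ)) ^ 8 := by
  have ht := I.t_pos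
  have hN0 : (0 : ℝ) ≤ I.N := Nat.cast_nonneg _
  have hL0 : 0 ≤ Real.log (1 / δ) := Real.log_nonneg (by rw [le_div_iff₀ hδ]; linarith)
  have hε0 : 0 < 1 / ε := by positivity
  have hq0 : 0 ≤ maxAbs I.A ^ 2 / I.t := by positivity
  set X := 1 + I.size + 1 / ε + Real.log (1 / δ) with hX
  have hsize : I.size = I.N + maxAbs I.A ^ 2 / I.t := rfl
  have hX1 : 1 ≤ X := by linarith
  -- The crude log 4 ≤ 3 suffices. The other factors a²/t, N and 1/ε are each at most X, so the
  -- bracket is at most 4X⁵ and the total degree is 8.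
  have hlog : Real.log (4 / δ) ≤ 3 * X := by
    rw [show 4 / δ = 4 * (1 / δ) by ring, Real.log_mul (by norm_num) (by positivity)]
    have := Real.log_le_sub_one_of_pos (show (0 : ℝ) < 4 by norm_num)
    linarith
  have hlog0 : 0 ≤ Real.log (4 / δ) := Real.log_nonneg (by rw [le_div_iff₀ hδ]; linarith)
  have e : maxAbs I.A ^ 2 * I.N * Real.log (4 / δ) / (I.t * ε ^ 2) =
      maxAbs I.A ^ 2 / I.t * I.N * Real.log (4 / δ) * (1 / ε) ^ 2 := by
    field_simp
  have hQ : maxAbs I.A ^ 2 / I.t * I.N * Real.log (4 / δ) * (1 / ε) ^ 2 ≤ X * X * (3 * X) * X ^ 2 := by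
    gcongr <;> linarith
  rw [e]
  calc _ ≤ 8000 * X ^ 3 * (1 + X * X * (3 * X) * X ^ 2) := by
        gcongr
        linarith
    _ ≤ 8000 * X ^ 3 * (X ^ 5 + X * X * (3 * X) * X ^ 2) := by
        gcongr
        exact one_le_pow₀ hX1
    _ = 32000 * X ^ 8 := by ring

end Approximation

theorem measurable_geomMeanDet_sample (I : Instance) (k : ℕ) :
    Measurable fun x : ℕ → ℝ =>
      geomMeanDet I.A I.t fun (l : Fin k) q => x (sampleIndex I.N k (l, q)) := by
  unfold geomMeanDet
  refine (Finset.measurable_prod _ fun l _ => (measurable_detY I.A I.t).comp ?_).pow_const _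
  fun_prop

end MatchPoly

/-! ### Assembly of the three assertions -/

theorem theorem4p1 :
    (∀ (N : ℕ) (A : Matrix (Fin N) (Fin N) ℝ) (hA : Aᵀ = -A), A ≠ 0 → ∀ t : ℝ, 0 < t →
      -- `log det (√t I + Y_A)` makes sense and has an expectation
      (∀ ξ, 0 < detY A t ξ) ∧
      Integrable (fun ξ => Real.log (detY A t ξ)) (gaussianEntries N) ∧
      -- concentration of the mean over `k` independent samples
      (∀ (k : ℕ), 1 ≤ k → ∀ (Ω : Type*) [MeasurableSpace Ω] (P : Measure Ω)
        [IsProbabilityMeasure P] (X : Fin k → Sym2 (Fin N) → Ω → ℝ),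
        (∀ l p, HasLaw (X l p) (gaussianReal 0 1) P) →
        iIndepFun (fun q : Fin k × Sym2 (Fin N) => X q.1 q.2) P →
        ∀ r : ℝ, 0 ≤ r →
          P.real {ω | N * r ≤
              |(1 / (k : ℝ)) * ∑ l, Real.log (detY A t fun p => X l p ω) - logPhiTilde A t|}
            ≤ 2 * Real.exp (-(t * k * N * r ^ 2) / (2 * maxAbs A ^ 2))) ∧
      -- the two-sided estimate; for odd `N` the expected determinant is `√t Φ`
      (Even N →
        1 / (N : ℝ) * logPhiTilde A t ≤ 1 / (N : ℝ) * Real.log (Phi A hA t) ∧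
        1 / (N : ℝ) * Real.log (Phi A hA t) ≤
          1 / (N : ℝ) * logPhiTilde A t + maxAbs A ^ 2 / (2 * t)) ∧
      (Odd N →
        1 / (N : ℝ) * logPhiTilde A t ≤ 1 / (N : ℝ) * Real.log (Real.sqrt t * Phi A hA t) ∧
        1 / (N : ℝ) * Real.log (Real.sqrt t * Phi A hA t) ≤
          1 / (N : ℝ) * logPhiTilde A t + maxAbs A ^ 2 / (2 * t))) ∧
    -- one program, which outputs the geometric mean of `k` sampled determinants, is an FPRAS
    (∃ p : RealRAM.Program,
      RealRAM.IsFPRAS p Instance.input Instance.size (fun I => PhiTilde I.A I.t) ∧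
      ∃ C : ℝ, ∀ (I : Instance) (ε δ : ℝ), 0 < ε → ε < 1 → 0 < δ → δ < 1 →
        ∃ e : Fin (I.sampleCount ε δ) × Sym2 (Fin I.N) ↪ ℕ,
          (∀ x : ℕ → ℝ, ∃ s : ℕ,
            RealRAM.HaltsWith x p (I.input ε δ) s
              (geomMeanDet I.A I.t fun l q => x (e (l, q))) ∧
            (s : ℝ) ≤ C * (I.N : ℝ) ^ 3 *
              (1 + maxAbs I.A ^ 2 * I.N * Real.log (4 / δ) / (I.t * ε ^ 2))) ∧
          1 - δ ≤ RealRAM.gaussianSamples.real {x |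
            1 - ε < geomMeanDet I.A I.t (fun l q => x (e (l, q))) / PhiTilde I.A I.t ∧
            geomMeanDet I.A I.t (fun l q => x (e (l, q))) / PhiTilde I.A I.t < 1 + ε ∧
            ∀ l i j, |Y I.A (fun q => x (e (l, q))) i j| ≤ maxAbs I.A *
              Real.sqrt (2 * Real.log ((I.N : ℝ) ^ 2 * I.sampleCount ε δ / δ))}) := by

  refine ⟨?_, approxProgram, ?_, 8000, ?_⟩
  · intro N A hA hA0 t ht
    have hN : (0 : ℝ) < N := by
      rcases N.eq_zero_or_pos with rfl | h
      · exact absurd (Subsingleton.elim _ _) hA0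
      · exact_mod_cast h
    have hupper := logPhiTilde_le_log_integral hA ht
    have hlower := log_integral_detY_le hA ht
    rw [integral_detY_eq_Phi hA ht.le] at hupper hlower
    have hscale : 1 / (N : ℝ) * (logPhiTilde A t + maxAbs A ^ 2 * N / (2 * t)) =
        1 / (N : ℝ) * logPhiTilde A t + maxAbs A ^ 2 / (2 * t) := by
      field_simp
    have hN' : 0 ≤ 1 / (N : ℝ) := by positivity
    refine ⟨detY_pos hA ht, integrable_log_detY hA ht, ?_, ?_, ?_⟩
    · intro k hk Ω _ P _ X hX hi r hr
      exact mean_log_detY_concentration hA hA0 ht hk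
        (hasLaw_stdGauss_of_iIndepFun (fun q => hX q.1 q.2) hi) hr
    · intro hE
      rw [Nat.even_iff.1 hE, pow_zero, one_mul] at hupper hlower
      refine ⟨mul_le_mul_of_nonneg_left hupper hN', ?_⟩
      rw [← hscale]
      exact mul_le_mul_of_nonneg_left hlower hN'
    · intro hO
      rw [Nat.odd_iff.1 hO, pow_one] at hupper hlower
      refine ⟨mul_le_mul_of_nonneg_left hupper hN', ?_⟩
      rw [← hscale]
      exact mul_le_mul_of_nonneg_left hlower hN'
  · refine ⟨32000, 8, fun I ε δ hε hε' hδ hδ' => ⟨_,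
      measurable_geomMeanDet_sample I (I.sampleCount ε δ), fun x => ?_, ?_⟩⟩
    · obtain ⟨s, τ, he, hs, hτ⟩ := runs_approxProgram I hε hδ hδ' x
      exact ⟨s, ⟨τ, he, hτ⟩, (cost_le I hε hδ hδ' hs).trans (cost_le_poly I hε hδ hδ')⟩
    · exact (approximation_probability I hε hε' hδ hδ').trans
        (measureReal_mono fun x hx => ⟨hx.1, hx.2.1⟩)
  · intro I ε δ hε hε' hδ hδ'
    refine ⟨sampleIndex I.N (I.sampleCount ε δ), fun x => ?_,
      approximation_probability I hε hε' hδ hδ'⟩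
    obtain ⟨s, τ, he, hs, hτ⟩ := runs_approxProgram I hε hδ hδ' x
    exact ⟨s, ⟨τ, he, hτ⟩, cost_le I hε hδ hδ' hs⟩
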